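/- Let $d\ge 1$, $1<p<\infty$ and $\frac1p+\frac1{p'}=1$. Cubes in $\mathbb R^d$ are the half-open cubes $\prod_{i=1}^d[a_i,a_i+\ell)$ with $\ell>0$. A dyadic grid is a collection $\mathcal D$ of cubes such that any two of them are disjoint or nested, each $Q\in\mathcal D$ is the union of $2^d$ cubes in $\mathcal D$ of equal volume, and for each $Q\in\mathcal D$ the cubes $Q'\in\mathcal D$ with $|Q'|=|Q|$ partition $\mathbb R^d$. Write $\mathbb E_Q f=|Q|^{-1}\int_Q f\,dx$. A collection $\mathcal L\subset\mathcal D$ is of type $L$ with constant $\Lambda>0$ if $$\sup_{Q\in\mathcal L}\ \mathbb E_Q\exp\Bigl(\Lambda^{-1}\sum_{Q'\in\mathcal L:\,Q'\subset Q}\mathbf 1_{Q'}\Bigr)\le 2 ,$$ and one sets $T_{\mathcal L}f=\sum_{Q\in\mathcal L}\mathbf 1_Q\,\mathbb E_Q f$. A weight is a non-negative locally integrable function $w$ on $\mathbb R^d$, identified with the measure $w\,dx$, so that $w(Q)=\int_Q w\,dx$. For weights $w,\sigma$ put $$[w,\sigma]_{A_p}=\sup_Q\Bigl[\frac{w(Q)}{|Q|}\Bigr]^{1/p}\Bigl[\frac{\sigma(Q)}{|Q|}\Bigr]^{1/p'},\qquad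 \|w\|_{A_\infty}=\sup_Q\frac1{w(Q)}\int_Q M(w\mathbf 1_Q)\,dx,$$ where the first supremum is over all cubes $Q$, the second over all cubes with $w(Q)>0$ (and it is $0$ if there are none), and $Mf(x)=\sup_{t>0}(2t)^{-d}\int_{[-t,t]^d}|f(x+y)|\,dy$. In products, $0\cdot\infty=0$. Then there is a constant $C$, depending only on $d$ and $p$, such that for every dyadic grid $\mathcal D$, every $\mathcal L\subset\mathcal D$ of type $L$ with constant $\Lambda$, all weights $w,\sigma$, and every complex-valued $f\in L^p(\sigma)$, $$\|T_{\mathcal L}(f\sigma)\|_{L^{p,\infty}(w)}\le C\,\Lambda\,[w,\sigma]_{A_p}\,\|w\|_{A_\infty}^{1/p'}\,\|f\|_{L^p(\sigma)},$$ $$\|T_{\mathcal L}(f\sigma)\|_{L^{p}(w)}\le C\,\Lambda\,[w,\sigma]_{A_p}\,\max\bigl\{\|\sigma\|_{A_\infty}^{1/p},\ \|w\|_{A_\infty}^{1/p'}\bigr\}\,\|f\|_{L^p(\sigma)},$$ where $\|g\|_{L^{p,\infty}(w)}=\sup_{t>0}t\,w(\{|g|>t\})^{1/p}$. Here $f\sigma$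 is integrable on each $Q\in\mathcal L$, and the series defining $T_{\mathcal L}(f\sigma)$ converges absolutely $w$-almost everywhere whenever $[w,\sigma]_{A_p}\|w\|_{A_\infty}^{1/p'}<\infty$. (Otherwise the two right-hand sides are infinite and the inequalities have no content for $f\neq0$ in $L^p(\sigma)$, and the sum may be given the value $0$ where it does not converge absolutely; for $f=0$ in $L^p(\sigma)$ all its terms vanish.) -/

import Mathlib

open MeasureTheory Set
open scoped ENNReal NNReal

noncomputable section

/-- Cubes in `ℝ^d`: products of `d` intervals `[a i, a i + ℓ)` of a common length `ℓ > 0`. -/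
def IsCube {d : ℕ} (Q : Set (Fin d → ℝ)) : Prop :=
  ∃ (a : Fin d → ℝ) (ℓ : ℝ), 0 < ℓ ∧ Q = Set.univ.pi fun i => Set.Ico (a i) (a i + ℓ)

/-- Dyadic grids in `ℝ^d`. -/
structure IsDyadicGrid {d : ℕ} (D : Set (Set (Fin d → ℝ))) : Prop where
  isCube : ∀ Q ∈ D, IsCube Q
  /-- Any two cubes are disjoint or nested. -/
  nested : ∀ Q ∈ D, ∀ R ∈ D, Q ∩ R = ∅ ∨ Q ∩ R = Q ∨ Q ∩ R = R
  /-- Each cube is the union of `2 ^ d` cubes of the grid of equal volume, its children. -/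
  children : ∀ Q ∈ D, ∃ 𝒞 ⊆ D, 𝒞.ncard = 2 ^ d ∧ ⋃₀ 𝒞 = Q ∧
    ∀ R ∈ 𝒞, volume R = volume Q / 2 ^ d
  /-- The cubes of the grid of the volume of a given one partition `ℝ^d`. -/
  partition : ∀ Q ∈ D, ∀ x : Fin d → ℝ, ∃! R, R ∈ D ∧ volume R = volume Q ∧ x ∈ R

/-- Weights on `ℝ^d`: non-negative locally integrable functions. -/
structure IsWeight {d : ℕ} (w : (Fin d → ℝ) → ℝ) : Prop where
  nonneg : ∀ x, 0 ≤ w x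
  locallyIntegrable : LocallyIntegrable w volume

/-- The measure `w(x) dx` with density a weight `w`. -/
def weightMeasure {d : ℕ} (w : (Fin d → ℝ) → ℝ) : Measure (Fin d → ℝ) :=
  volume.withDensity fun x => ENNReal.ofReal (w x)

/-- The two weight characteristic `sup_Q (w(Q)/|Q|)^{1/p} (σ(Q)/|Q|)^{1/q}`, over all cubes;
here `q` is the exponent dual to `p`. -/
def twoWeightAp {d : ℕ} (p q : ℝ) (w σ : (Fin d → ℝ) → ℝ) : ℝ≥0∞ :=
  ⨆ (Q : Set (Fin d → ℝ)) (_ : IsCube Q),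
    (weightMeasure w Q / volume Q) ^ (1 / p) * (weightMeasure σ Q / volume Q) ^ (1 / q)

/-- The maximal function `M f(x) = sup_{t > 0} (2t)^{-d} ∫_{[-t,t]^d} |f(x + y)| dy`. -/
def maximalFunction {d : ℕ} (f : (Fin d → ℝ) → ℝ) (x : Fin d → ℝ) : ℝ≥0∞ :=
  ⨆ (t : ℝ) (_ : 0 < t), (ENNReal.ofReal ((2 * t) ^ d))⁻¹ *
    ∫⁻ y in Set.univ.pi (fun _ : Fin d => Set.Icc (-t) t), ‖f (x + y)‖ₑ

/-- `‖w‖_{A_∞} = sup_Q w(Q)⁻¹ ∫_Q M(w 1_Q) dx`, over all cubes. A cube with `w(Q) = 0` does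
not contribute, because then `M(w 1_Q) = 0` and `∞ * 0 = 0`. -/
def aInfty {d : ℕ} (w : (Fin d → ℝ) → ℝ) : ℝ≥0∞ :=
  ⨆ (Q : Set (Fin d → ℝ)) (_ : IsCube Q),
    (weightMeasure w Q)⁻¹ * ∫⁻ x in Q, maximalFunction (Q.indicator w) x

/-- `L` is of type `L` with constant `Λ`: for each `Q ∈ L`, the average over `Q` of
`exp (Λ⁻¹ ∑ 1_{Q'})`, the sum over all `Q' ∈ L` with `Q' ⊆ Q`, is at most `2`.
The sum may be infinite, and `exp ∞ = ∞`. -/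
def IsTypeL {d : ℕ} (L : Set (Set (Fin d → ℝ))) (Λ : ℝ) : Prop :=
  0 < Λ ∧ ∀ Q ∈ L,
    ⨍⁻ x in Q, EReal.exp
      (((ENNReal.ofReal Λ)⁻¹ *
        ∑' R : {R : Set (Fin d → ℝ) // R ∈ L ∧ R ⊆ Q},
          R.1.indicator (fun _ => (1 : ℝ≥0∞)) x : ℝ≥0∞) : EReal) ∂volume ≤ 2

/-- The summand `1_Q(x) E_Q f`, where `E_Q f` is the Lebesgue average of `f` over `Q`. -/
def cubeTerm {d : ℕ} (Q : Set (Fin d → ℝ)) (f : (Fin d → ℝ) → ℂ) (x : Fin d → ℝ) : ℂ :=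
  Q.indicator (fun _ => ⨍ y in Q, f y ∂volume) x

/-- The operator `T_L f = ∑_{Q ∈ L} 1_Q E_Q f`. -/
def dyadicOp {d : ℕ} (L : Set (Set (Fin d → ℝ))) (f : (Fin d → ℝ) → ℂ) (x : Fin d → ℝ) : ℂ :=
  ∑' Q : L, cubeTerm Q.1 f x

/-- The weak norm of `L^{p,∞}(μ)`: `sup_{t > 0} t μ{|g| > t}^{1/p}`. -/
def weakLpNorm {d : ℕ} (g : (Fin d → ℝ) → ℂ) (p : ℝ) (μ : Measure (Fin d → ℝ)) : ℝ≥0∞ :=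
  ⨆ (t : ℝ≥0) (_ : 0 < t), (t : ℝ≥0∞) * μ {x | t < ‖g x‖₊} ^ (1 / p)

end

/-!
# The two weight `A_p`-`A_∞` inequality for dyadic families of type `L`

Since `|E_Q (σ f)| ≤ |Q|⁻¹ ∫_Q |f| dσ`, all bounds follow from those for the positive operator
`T g = ∑_{Q ∈ L} 1_Q |Q|⁻¹ ∫_Q g dσ` (`posOp`). A dyadic grid is countable
(`IsDyadicGrid.countable`), so that by monotone convergence `L` may be replaced by its finite
subfamilies. Of the type `L` condition only the packing condition `∑_{R ⊆ Q} |R| ≤ 2 Λ |Q|` is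
used (`IsTypeL.sum_volume_le`, from `y ≤ exp y`); families with this property are called Carleson
here. Everything is done with values in `ℝ≥0∞`, with the convention `0 * ∞ = 0`, so that infinite
or vanishing characteristics need no separate treatment, except in the absorption argument below.

Both bounds are reduced to testing conditions. Write `a_Q = σ(Q) / |Q|`, `b_Q = w(Q) / |Q|`.

* Testing. The condition `∫ (∑_{R ⊆ Q} a_R 1_R)^p dw ≤ C Λ^p [w, σ]^p ‖σ‖_{A_∞} σ(Q)` is
  `exists_testing`. Summation by parts along chains (`IsLaminar.stepSum_rpow_le`) gives
  `(∑ a_R 1_R)^p ≤ p ∑_R a_R 1_R (∑_{R' ⊆ R} a_{R'} 1_{R'})^(p-1)`. The integral over `R` of the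
  power `p - 1` is at most `C Λ^(p-1) [w, σ]^p |R|` when `a_R ≠ 0` (`exists_local_testing`):
  the `A_p` condition removes one of the two weights from each product `a_R b_R`, and what is left
  is a sum `∑_{R ⊆ Q} c_R^s |R|` with `c = a` or `c = b` and an exponent `s < 1`. As in the weak
  `L¹` bound for averages, it is at most `C Λ c_Q^s |Q|` (`IsCarleson.sum_avg_rpow_le`). Then
  `∑_{R ⊆ Q} σ(R) ≤ C Λ ‖σ‖_{A_∞} σ(Q)` (`IsWeight.sum_below_le`), as the `σ(R)` are dominated by
  the integral of the maximal function (`IsCarleson.sum_measure_le_lintegral`).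
* Weak type. On a maximal cube `Q` of `{T g > t}` the part of `T g` from cubes above `Q` is at most
  `t`, so that `{T g > 2 t}` is controlled by duality and the testing condition for `w` on these
  cubes (`IsCarleson.mul_measure_superlevel_le`). This gives a bound of
  `N = sup_t t^p w{T g > t}` in terms of `N^(1/q)`, and `N < ∞` for finite families.
* Strong type. In the bilinear form `∑ |Q|⁻¹ ∫_Q g dσ ∫_Q h dw` the cubes are split according to
  which of `⟨g⟩_Q^p σ(Q)` and `⟨h⟩_Q^q w(Q)` is larger. If it is the first, then stopping cubes
  for the averages of `g` alone suffice: `h` may be averaged over the stopping children, where its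
  energy is controlled by that of `g` (`IsCarleson.sum_le_of_gavg_le`), and the energies over the
  stopping cubes are summable by a Carleson embedding (`IsStopping.sum_gavg_rpow_le`). With
  `h = ε (T g)^(p-1)` and `ε` small this yields the strong bound
  (`IsCarleson.lintegral_stepSum_coef_rpow_le`).

The sums over stopping cubes are all estimated by the same device: the contribution of the children
of a stopping cube is at most half of its own contribution, up to a good term, and is absorbed
(`ENNReal.le_two_mul_of_le_add_half`).
-/

/-! ### Laminar families and stopping cubes -/

/-- A finite family of nonempty sets, any two of which are disjoint or nested. -/
structure IsLaminar {X : Type*} (L : Finset (Set X)) : Prop where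
  nonempty : ∀ Q ∈ L, Q.Nonempty
  nested : ∀ Q ∈ L, ∀ R ∈ L, Disjoint Q R ∨ Q ⊆ R ∨ R ⊆ Q

lemma IsLaminar.mono {X : Type*} {L L' : Finset (Set X)} (h : IsLaminar L) (hL : L' ⊆ L) :
    IsLaminar L' :=
  ⟨fun Q hQ => h.nonempty Q (hL hQ), fun Q hQ R hR => h.nested Q (hL hQ) R (hL hR)⟩

lemma IsLaminar.comparable {X : Type*} {L : Finset (Set X)} (h : IsLaminar L)
    {R F G : Set X} (hR : R.Nonempty) (hF : F ∈ L) (hG : G ∈ L) (hRF : R ⊆ F) (hRG : R ⊆ G) :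
    F ⊆ G ∨ G ⊆ F := by
  obtain ⟨x, hx⟩ := hR
  rcases h.nested F hF G hG with h1 | h1
  · exact absurd (hRG hx) (Set.disjoint_left.1 h1 (hRF hx))
  · exact h1

/-- `S` is the family of stopping sets in `L` for the function `a` and the ratio `r`: a set of `L`
is selected when its value of `a` exceeds `r` times that of each selected set strictly above. -/
structure IsStopping {X : Type*} (L S : Finset (Set X)) (a : Set X → ℝ≥0∞) (r : ℝ≥0∞) :
    Prop where
  subset : S ⊆ L
  mem_iff : ∀ R ∈ L, R ∈ S ↔ ∀ F ∈ S, R ⊂ F → r * a F < a R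

lemma exists_isStopping {X : Type*} (L : Finset (Set X)) (a : Set X → ℝ≥0∞) (r : ℝ≥0∞) :
    ∃ S, IsStopping L S a r := by
  classical
  induction hn : L.card generalizing L with
  | zero =>
    rw [Finset.card_eq_zero] at hn
    subst hn
    exact ⟨∅, by simp, by simp⟩
  | succ n ih =>
    have hne : L.Nonempty := by
      rw [← Finset.card_pos]; omega
    obtain ⟨R, hR⟩ := L.exists_minimal hne
    obtain ⟨S, hS⟩ := ih (L.erase R) (by rw [Finset.card_erase_of_mem hR.1]; omega)
    have key : ∀ Q ∈ L, ¬ Q ⊂ R := fun Q hQ hlt => hlt.2 (hR.2 hQ hlt.1)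
    have hRS : R ∉ S := fun h => by simpa using hS.subset h
    by_cases hc : ∀ F ∈ S, R ⊂ F → r * a F < a R
    · refine ⟨insert R S, ?_, ?_⟩
      · intro Q hQ
        rcases Finset.mem_insert.1 hQ with rfl | hQ
        · exact hR.1
        · exact Finset.mem_of_mem_erase (hS.subset hQ)
      · intro Q hQ
        by_cases hQR : Q = R
        · subst hQR
          simpa using hc
        · have := hS.mem_iff Q (Finset.mem_erase.2 ⟨hQR, hQ⟩)
          simp only [Finset.mem_insert, hQR, false_or, this, forall_eq_or_imp]
          exact ⟨fun h => ⟨fun h' => absurd h' (key Q hQ), h⟩, fun h => h.2⟩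
    · refine ⟨S, fun Q hQ => Finset.mem_of_mem_erase (hS.subset hQ), ?_⟩
      intro Q hQ
      by_cases hQR : Q = R
      · subst hQR
        exact ⟨fun h => absurd h hRS, fun h => absurd h hc⟩
      · exact hS.mem_iff Q (Finset.mem_erase.2 ⟨hQR, hQ⟩)

/-- The smallest stopping set containing a given set `R` of the family has at least `1 / r` times
the value of `R`. -/
lemma IsStopping.exists_proj {X : Type*} {L S : Finset (Set X)} {a : Set X → ℝ≥0∞} {r : ℝ≥0∞}
    (h : IsStopping L S a r) (hL : IsLaminar L) (hr : 1 ≤ r) {R : Set X} (hR : R ∈ L) :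
    ∃ F ∈ S, R ⊆ F ∧ (∀ G ∈ S, R ⊆ G → F ⊆ G) ∧ a R ≤ r * a F := by
  classical
  obtain ⟨F₁, hF₁, hRF₁, hle⟩ : ∃ F ∈ S, R ⊆ F ∧ a R ≤ r * a F := by
    by_cases hRS : R ∈ S
    · exact ⟨R, hRS, subset_rfl, le_mul_of_one_le_left' hr⟩
    · have := mt (h.mem_iff R hR).2 hRS
      push Not at this
      obtain ⟨F, hF, hRF, hle⟩ := this
      exact ⟨F, hF, hRF.1, hle⟩
  obtain ⟨F, hF⟩ := (S.filter fun G => R ⊆ G).exists_minimal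
    ⟨F₁, Finset.mem_filter.2 ⟨hF₁, hRF₁⟩⟩
  have hFm := Finset.mem_filter.1 hF.1
  have hmin : ∀ G ∈ S, R ⊆ G → F ⊆ G := by
    intro G hG hRG
    rcases hL.comparable (hL.nonempty R hR) (h.subset hFm.1) (h.subset hG) hFm.2 hRG with h1 | h1
    · exact h1
    · exact hF.2 (Finset.mem_filter.2 ⟨hG, hRG⟩) h1
  refine ⟨F, hFm.1, hFm.2, hmin, ?_⟩
  rcases (hmin F₁ hF₁ hRF₁).eq_or_ssubset with rfl | hlt
  · exact hle
  · exact (hle.trans ((h.mem_iff F (h.subset hFm.1)).1 hFm.1 F₁ hF₁ hlt).le).trans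
      (le_mul_of_one_le_left' hr)

open Classical in
/-- The maximal sets of `S` strictly contained in `F`. -/
noncomputable def children {X : Type*} (S : Finset (Set X)) (F : Set X) : Finset (Set X) :=
  S.filter fun R => R ⊂ F ∧ ∀ G ∈ S, R ⊂ G → F ⊆ G

/-- The part of `F` not covered by smaller sets of `S`. -/
def remainder {X : Type*} (S : Finset (Set X)) (F : Set X) : Set X :=
  F \ ⋃ R ∈ children S F, R

lemma mem_children {X : Type*} {S : Finset (Set X)} {F R : Set X} :
    R ∈ children S F ↔ R ∈ S ∧ R ⊂ F ∧ ∀ G ∈ S, R ⊂ G → F ⊆ G := by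
  simp [children]

lemma IsLaminar.exists_child {X : Type*} {S : Finset (Set X)} (h : IsLaminar S) {R F : Set X}
    (hR : R ∈ S) (hF : F ∈ S) (hRF : R ⊂ F) : ∃ C ∈ children S F, R ⊆ C := by
  classical
  obtain ⟨C, hC⟩ := (S.filter fun G => R ⊆ G ∧ G ⊂ F).exists_maximal
    ⟨R, Finset.mem_filter.2 ⟨hR, subset_rfl, hRF⟩⟩
  have hCm := Finset.mem_filter.1 hC.1
  refine ⟨C, mem_children.2 ⟨hCm.1, hCm.2.2, fun G hG hCG => ?_⟩, hCm.2.1⟩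
  by_contra hFG
  have hRG : R ⊆ G := hCm.2.1.trans hCG.1
  have hGF : G ⊆ F := by
    rcases h.comparable (h.nonempty R hR) hF hG hRF.1 hRG with h1 | h1
    · exact absurd h1 hFG
    · exact h1
  exact hCG.2 (hC.2 (Finset.mem_filter.2 ⟨hG, hRG, hGF, hFG⟩) hCG.1)

lemma IsLaminar.exists_parent {X : Type*} {S : Finset (Set X)} (h : IsLaminar S) {R G : Set X}
    (hR : R ∈ S) (hG : G ∈ S) (hRG : R ⊂ G) : ∃ F ∈ S, R ∈ children S F := by
  classical
  obtain ⟨F, hF⟩ := (S.filter fun G => R ⊂ G).exists_minimal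
    ⟨G, Finset.mem_filter.2 ⟨hG, hRG⟩⟩
  have hFm := Finset.mem_filter.1 hF.1
  refine ⟨F, hFm.1, mem_children.2 ⟨hR, hFm.2, fun G' hG' hRG' => ?_⟩⟩
  rcases h.comparable (h.nonempty R hR) hFm.1 hG' hFm.2.1 hRG'.1 with h1 | h1
  · exact h1
  · exact hF.2 (Finset.mem_filter.2 ⟨hG', hRG'⟩) h1

lemma IsLaminar.children_disjoint {X : Type*} {S : Finset (Set X)} (h : IsLaminar S) (F : Set X) :
    (children S F : Set (Set X)).PairwiseDisjoint id := by
  intro C hC C' hC' hne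
  rw [Finset.mem_coe, mem_children] at hC hC'
  rcases h.nested C hC.1 C' hC'.1 with h1 | h1 | h1
  · exact h1
  · exact absurd (hC.2.2 C' hC'.1 (h1.ssubset_of_ne hne)) hC'.2.1.2
  · exact absurd (hC'.2.2 C hC.1 (h1.ssubset_of_ne hne.symm)) hC.2.1.2

lemma children_pairwiseDisjoint {X : Type*} (S : Finset (Set X)) :
    (S : Set (Set X)).PairwiseDisjoint (children S) := by
  intro F hF F' hF' hne
  rw [Function.onFun, Finset.disjoint_left]
  intro R hR hR'
  rw [mem_children] at hR hR'
  exact hne ((hR.2.2 F' hF' hR'.2.1).antisymm (hR'.2.2 F hF hR.2.1))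

lemma remainder_subset {X : Type*} (S : Finset (Set X)) (F : Set X) : remainder S F ⊆ F :=
  sdiff_subset

lemma IsLaminar.remainder_disjoint {X : Type*} {S : Finset (Set X)} (h : IsLaminar S) :
    (S : Set (Set X)).PairwiseDisjoint (remainder S) := by
  have key : ∀ F ∈ S, ∀ F' ∈ S, F ⊂ F' → Disjoint (remainder S F) (remainder S F') := by
    intro F hF F' hF' hlt
    obtain ⟨C, hC, hFC⟩ := h.exists_child hF hF' hlt
    refine Set.disjoint_left.2 fun x hx hx' => hx'.2 ?_
    exact mem_biUnion hC (hFC hx.1)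
  intro F hF F' hF' hne
  rcases h.nested F hF F' hF' with h1 | h1 | h1
  · exact h1.mono (remainder_subset S F) (remainder_subset S F')
  · exact key F hF F' hF' (h1.ssubset_of_ne hne)
  · exact (key F' hF' F hF (h1.ssubset_of_ne hne.symm)).symm

lemma sum_children_le {X : Type*} (S : Finset (Set X)) (c : Set X → ℝ≥0∞) :
    ∑ F ∈ S, ∑ R ∈ children S F, c R ≤ ∑ F ∈ S, c F := by
  classical
  rw [← Finset.sum_biUnion (children_pairwiseDisjoint S)]
  refine Finset.sum_le_sum_of_subset fun R hR => ?_
  obtain ⟨F, -, hR⟩ := Finset.mem_biUnion.1 hR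
  exact (mem_children.1 hR).1

/-- A set projected to the stopping set `F` is disjoint from the children of `F` it does not
contain. -/
lemma IsLaminar.child_subset_or_disjoint {X : Type*} {L S : Finset (Set X)} (hL : IsLaminar L)
    (hS : S ⊆ L) {Q F C : Set X} (hQ : Q ∈ L) (hmin : ∀ G ∈ S, Q ⊆ G → F ⊆ G)
    (hC : C ∈ children S F) : C ⊆ Q ∨ Disjoint C Q := by
  rw [mem_children] at hC
  rcases hL.nested C (hS hC.1) Q hQ with h1 | h1 | h1
  · exact Or.inr h1
  · exact Or.inl h1
  · exact absurd (hmin C hC.1 h1) hC.2.1.2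

section Measure

variable {X : Type*} [MeasurableSpace X]

lemma IsLaminar.sum_measure_children_le {S : Finset (Set X)} (h : IsLaminar S)
    (hm : ∀ Q ∈ S, MeasurableSet Q) (ν : Measure X) (F : Set X) :
    ∑ R ∈ children S F, ν R ≤ ν F := by
  have h1 := measure_biUnion_finset (μ := ν) (h.children_disjoint F)
    (fun R hR => hm R (mem_children.1 hR).1)
  simp only [id] at h1
  rw [← h1]
  exact measure_mono (iUnion₂_subset fun R hR => (mem_children.1 hR).2.1.1)

lemma measurableSet_biUnion_children {S : Finset (Set X)}
    (hm : ∀ Q ∈ S, MeasurableSet Q) (F : Set X) : MeasurableSet (⋃ R ∈ children S F, R) :=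
  Finset.measurableSet_biUnion _ fun R hR => hm R (mem_children.1 hR).1

lemma measurableSet_remainder {S : Finset (Set X)} (hm : ∀ Q ∈ S, MeasurableSet Q) {F : Set X}
    (hF : F ∈ S) : MeasurableSet (remainder S F) :=
  (hm F hF).diff (measurableSet_biUnion_children hm F)

lemma IsLaminar.setLIntegral_eq {S : Finset (Set X)} (h : IsLaminar S)
    (hm : ∀ Q ∈ S, MeasurableSet Q) (ν : Measure X) (g : X → ℝ≥0∞) (F : Set X) :
    ∫⁻ x in F, g x ∂ν = ∫⁻ x in remainder S F, g x ∂ν + ∑ R ∈ children S F, ∫⁻ x in R, g x ∂ν := by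
  have h1 := lintegral_biUnion_finset (μ := ν) (h.children_disjoint F)
    (fun R hR => hm R (mem_children.1 hR).1) g
  simp only [id] at h1
  rw [← h1, add_comm, ← lintegral_inter_add_sdiff g F (measurableSet_biUnion_children hm F),
    inter_eq_self_of_subset_right (iUnion₂_subset fun R hR => (mem_children.1 hR).2.1.1)]
  rfl

lemma IsLaminar.sum_setLIntegral_remainder_le {S : Finset (Set X)} (h : IsLaminar S)
    (hm : ∀ Q ∈ S, MeasurableSet Q) (ν : Measure X) (g : X → ℝ≥0∞) :
    ∑ F ∈ S, ∫⁻ x in remainder S F, g x ∂ν ≤ ∫⁻ x in ⋃ F ∈ S, F, g x ∂ν := by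
  rw [← lintegral_biUnion_finset h.remainder_disjoint
    (fun F hF => measurableSet_remainder hm hF) g]
  exact lintegral_mono_set (iUnion₂_mono fun F _ => remainder_subset S F)

end Measure

/-! ### Carleson families -/

section Carleson

variable {X : Type*} [MeasurableSpace X]

/-- A finite laminar family of measurable sets of positive finite measure that satisfies the
Carleson packing condition with constant `Λ`. -/
structure IsCarleson (μ : Measure X) (L : Finset (Set X)) (Λ : ℝ≥0∞) : Prop
    extends IsLaminar L where
  measurable : ∀ Q ∈ L, MeasurableSet Q
  ne_zero : ∀ Q ∈ L, μ Q ≠ 0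
  ne_top : ∀ Q ∈ L, μ Q ≠ ∞
  sum_le : ∀ Q ∈ L, ∀ K ⊆ L, (∀ R ∈ K, R ⊆ Q) → ∑ R ∈ K, μ R ≤ Λ * μ Q

lemma IsCarleson.mono {μ : Measure X} {L L' : Finset (Set X)} {Λ : ℝ≥0∞}
    (h : IsCarleson μ L Λ) (hL : L' ⊆ L) : IsCarleson μ L' Λ where
  toIsLaminar := h.toIsLaminar.mono hL
  measurable Q hQ := h.measurable Q (hL hQ)
  ne_zero Q hQ := h.ne_zero Q (hL hQ)
  ne_top Q hQ := h.ne_top Q (hL hQ)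
  sum_le Q hQ K hK := h.sum_le Q (hL hQ) K (hK.trans hL)

/-- The average `ν(Q) / μ(Q)`. -/
noncomputable def avg (μ ν : Measure X) (Q : Set X) : ℝ≥0∞ := ν Q / μ Q

lemma IsCarleson.avg_mul {μ : Measure X} {L : Finset (Set X)} {Λ : ℝ≥0∞}
    (h : IsCarleson μ L Λ) (ν : Measure X) {Q : Set X} (hQ : Q ∈ L) : avg μ ν Q * μ Q = ν Q :=
  ENNReal.div_mul_cancel (h.ne_zero Q hQ) (h.ne_top Q hQ)

lemma IsCarleson.avg_ne_top {μ : Measure X} {L : Finset (Set X)} {Λ : ℝ≥0∞}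
    (h : IsCarleson μ L Λ) {ν : Measure X} {Q : Set X} (hQ : Q ∈ L) (hν : ν Q ≠ ∞) :
    avg μ ν Q ≠ ∞ :=
  ENNReal.div_ne_top hν (h.ne_zero Q hQ)

lemma ENNReal.le_two_mul_of_le_add_half {x y : ℝ≥0∞} (hx : x ≠ ∞) (h : x ≤ y + 2⁻¹ * x) :
    x ≤ 2 * y := by
  have h1 : x / 2 ≠ ∞ := ENNReal.div_ne_top hx (by norm_num)
  have h2 : x / 2 + x / 2 ≤ y + x / 2 := by
    rw [ENNReal.add_halves]
    simpa [div_eq_mul_inv, mul_comm] using h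
  have h3 := (ENNReal.add_le_add_iff_right h1).1 h2
  calc x = 2 * (x / 2) := by rw [two_mul, ENNReal.add_halves]
    _ ≤ 2 * y := by gcongr

lemma IsCarleson.sum_rpow_mul_le_sum_stopping {μ : Measure X} {L S : Finset (Set X)}
    {Λ r : ℝ≥0∞} {a : Set X → ℝ≥0∞} (h : IsCarleson μ L Λ) (hS : IsStopping L S a r)
    (hr : 1 ≤ r) {s : ℝ} (hs : 0 ≤ s) :
    ∑ R ∈ L, a R ^ s * μ R ≤ r ^ s * Λ * ∑ F ∈ S, a F ^ s * μ F := by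
  classical
  have := fun R hR => hS.exists_proj h.toIsLaminar hr (R := R) hR
  choose! π hπS hπ hmin hle using this
  rw [← Finset.sum_fiberwise_of_maps_to hπS, Finset.mul_sum]
  refine Finset.sum_le_sum fun F hF => ?_
  calc ∑ R ∈ L with π R = F, a R ^ s * μ R
      ≤ ∑ R ∈ L with π R = F, (r * a F) ^ s * μ R := by
        refine Finset.sum_le_sum fun R hR => ?_
        rw [Finset.mem_filter] at hR
        gcongr
        exact hR.2 ▸ hle R hR.1
    _ = (r * a F) ^ s * ∑ R ∈ L with π R = F, μ R := by rw [Finset.mul_sum]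
    _ ≤ (r * a F) ^ s * (Λ * μ F) := by
        gcongr
        refine h.sum_le F (hS.subset hF) _ (Finset.filter_subset _ _) fun R hR => ?_
        rw [Finset.mem_filter] at hR
        exact hR.2 ▸ hπ R hR.1
    _ = r ^ s * Λ * (a F ^ s * μ F) := by
        rw [ENNReal.mul_rpow_of_nonneg _ _ hs]; ring

/-- A Kolmogorov type inequality: the family of averages of `ν` is in weak `L¹` of the Carleson
measure, hence in `L^s` for `s < 1`. -/
lemma IsCarleson.sum_avg_rpow_le {μ : Measure X} {L : Finset (Set X)} {Λ : ℝ≥0∞}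
    (h : IsCarleson μ L Λ) {ν : Measure X} (hν : ∀ Q ∈ L, ν Q ≠ ∞) {s : ℝ} (hs : 0 ≤ s)
    (hs1 : s < 1) {Q : Set X} (hQ : Q ∈ L) {K : Finset (Set X)} (hKL : K ⊆ L)
    (hK : ∀ R ∈ K, R ⊆ Q) :
    ∑ R ∈ K, avg μ ν R ^ s * μ R ≤
      2 * ((2 : ℝ≥0∞) ^ (1 / (1 - s))) ^ s * Λ * (avg μ ν Q ^ s * μ Q) := by
  classical
  set r : ℝ≥0∞ := 2 ^ (1 / (1 - s)) with hr_def
  have hs' : 0 < 1 - s := by linarith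
  have hr : 1 ≤ r := ENNReal.one_le_rpow (by norm_num) (by positivity)
  have hr2 : r ^ (1 - s) = 2 := by
    rw [hr_def, ← ENNReal.rpow_mul, one_div, inv_mul_cancel₀ hs'.ne', ENNReal.rpow_one]
  set L' := L.filter (· ⊆ Q) with hL'
  have hL'L : L' ⊆ L := Finset.filter_subset _ _
  have h' := h.mono hL'L
  obtain ⟨S, hS⟩ := exists_isStopping L' (avg μ ν) r
  have hSlam := h'.toIsLaminar.mono hS.subset
  have hmS : ∀ F ∈ S, MeasurableSet F := fun F hF => h'.measurable F (hS.subset hF)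
  -- the sum over the children of `F` is at most half the term of `F`
  have hhalf : ∀ F ∈ S, ∑ R ∈ children S F, avg μ ν R ^ s * μ R ≤
      2⁻¹ * (avg μ ν F ^ s * μ F) := by
    intro F hF
    have hFL := hL'L (hS.subset hF)
    have hch : ∀ R ∈ children S F, R ∈ S ∧ R ⊂ F := fun R hR =>
      ⟨(mem_children.1 hR).1, (mem_children.1 hR).2.1⟩
    have hlt : ∀ R ∈ children S F, r * avg μ ν F < avg μ ν R := fun R hR =>
      (hS.mem_iff R (hS.subset (hch R hR).1)).1 (hch R hR).1 F hF (hch R hR).2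
    rcases eq_or_ne (avg μ ν F) 0 with h0 | h0
    · have hνF : ν F = 0 := by rw [← h.avg_mul ν hFL, h0, zero_mul]
      refine le_of_eq_of_le (Finset.sum_eq_zero fun R hR => ?_) zero_le
      have h1 := hlt R hR
      have h2 : ν R = 0 := measure_mono_null (hch R hR).2.1 hνF
      simp [avg, h2] at h1
    · have ht : avg μ ν F ≠ ∞ := h.avg_ne_top hFL (hν F hFL)
      have h1 : avg μ ν F ^ (1 - s) * (2 * ∑ R ∈ children S F, avg μ ν R ^ s * μ R) ≤
          avg μ ν F ^ (1 - s) * (avg μ ν F ^ s * μ F) := by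
        calc avg μ ν F ^ (1 - s) * (2 * ∑ R ∈ children S F, avg μ ν R ^ s * μ R)
            = ∑ R ∈ children S F, (r * avg μ ν F) ^ (1 - s) * (avg μ ν R ^ s * μ R) := by
              rw [ENNReal.mul_rpow_of_nonneg _ _ hs'.le, hr2, ← Finset.mul_sum]; ring
          _ ≤ ∑ R ∈ children S F, avg μ ν R ^ (1 - s) * (avg μ ν R ^ s * μ R) := by
              refine Finset.sum_le_sum fun R hR => ?_
              gcongr
              exact (hlt R hR).le
          _ = ∑ R ∈ children S F, ν R := by
              refine Finset.sum_congr rfl fun R hR => ?_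
              rw [← mul_assoc, ← ENNReal.rpow_add_of_nonneg _ _ hs'.le hs, sub_add_cancel,
                ENNReal.rpow_one, h.avg_mul ν (hL'L (hS.subset (hch R hR).1))]
          _ ≤ ν F := hSlam.sum_measure_children_le hmS ν F
          _ = avg μ ν F ^ (1 - s) * (avg μ ν F ^ s * μ F) := by
              rw [← mul_assoc, ← ENNReal.rpow_add_of_nonneg _ _ hs'.le hs, sub_add_cancel,
                ENNReal.rpow_one, h.avg_mul ν hFL]
      have h2 := (ENNReal.mul_le_mul_iff_right (by simp [ENNReal.rpow_eq_zero_iff, h0, ht])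
        (by simp [ENNReal.rpow_eq_top_iff, h0, ht])).1 h1
      calc ∑ R ∈ children S F, avg μ ν R ^ s * μ R
          = 2⁻¹ * (2 * ∑ R ∈ children S F, avg μ ν R ^ s * μ R) := by
            rw [← mul_assoc, ENNReal.inv_mul_cancel (by norm_num) (by norm_num), one_mul]
        _ ≤ _ := by gcongr
  have hfin : ∑ F ∈ S, avg μ ν F ^ s * μ F ≠ ∞ := by
    refine ENNReal.sum_ne_top.2 fun F hF => ?_
    have hFL := hL'L (hS.subset hF)
    exact ENNReal.mul_ne_top (ENNReal.rpow_ne_top_of_nonneg hs (h.avg_ne_top hFL (hν F hFL)))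
      (h.ne_top F hFL)
  have hsub : S ⊆ insert Q (S.biUnion (children S)) := by
    intro R hR
    have hRQ : R ⊆ Q := (Finset.mem_filter.1 (hS.subset hR)).2
    by_cases hne : R = Q
    · simp [hne]
    have hQS : Q ∈ S := by
      refine (hS.mem_iff Q (Finset.mem_filter.2 ⟨hQ, subset_rfl⟩)).2 fun F hF hlt => ?_
      exact absurd (Finset.mem_filter.1 (hS.subset hF)).2 hlt.2
    obtain ⟨F, hF, hRF⟩ := hSlam.exists_parent hR hQS (hRQ.ssubset_of_ne hne)
    exact Finset.mem_insert_of_mem (Finset.mem_biUnion.2 ⟨F, hF, hRF⟩)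
  have hsum : ∑ F ∈ S, avg μ ν F ^ s * μ F ≤
      avg μ ν Q ^ s * μ Q + 2⁻¹ * ∑ F ∈ S, avg μ ν F ^ s * μ F := by
    calc ∑ F ∈ S, avg μ ν F ^ s * μ F
        ≤ ∑ F ∈ insert Q (S.biUnion (children S)), avg μ ν F ^ s * μ F :=
          Finset.sum_le_sum_of_subset hsub
      _ ≤ avg μ ν Q ^ s * μ Q + ∑ F ∈ S.biUnion (children S), avg μ ν F ^ s * μ F := by
          by_cases hm : Q ∈ S.biUnion (children S)
          · rw [Finset.insert_eq_of_mem hm]; exact le_add_self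
          · rw [Finset.sum_insert hm]
      _ = avg μ ν Q ^ s * μ Q + ∑ F ∈ S, ∑ R ∈ children S F, avg μ ν R ^ s * μ R := by
          rw [Finset.sum_biUnion (children_pairwiseDisjoint S)]
      _ ≤ avg μ ν Q ^ s * μ Q + ∑ F ∈ S, 2⁻¹ * (avg μ ν F ^ s * μ F) := by
          gcongr with F hF
          exact hhalf F hF
      _ = _ := by rw [Finset.mul_sum]
  have hfinal := ENNReal.le_two_mul_of_le_add_half hfin hsum
  calc ∑ R ∈ K, avg μ ν R ^ s * μ R ≤ ∑ R ∈ L', avg μ ν R ^ s * μ R :=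
        Finset.sum_le_sum_of_subset fun R hR => Finset.mem_filter.2 ⟨hKL hR, hK R hR⟩
    _ ≤ r ^ s * Λ * ∑ F ∈ S, avg μ ν F ^ s * μ F :=
        h'.sum_rpow_mul_le_sum_stopping hS hr hs
    _ ≤ r ^ s * Λ * (2 * (avg μ ν Q ^ s * μ Q)) := by gcongr
    _ = _ := by ring

/-- The `ν`-measures of the sets of a Carleson family sum up to at most the integral of any
majorant `m` of the maximal function of `ν`. -/
lemma IsCarleson.sum_measure_le_lintegral {μ : Measure X} {L : Finset (Set X)} {Λ : ℝ≥0∞}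
    (h : IsCarleson μ L Λ) {ν : Measure X} (hν : ∀ Q ∈ L, ν Q ≠ ∞) {A : Set X}
    (hA : ∀ Q ∈ L, Q ⊆ A) (m : X → ℝ≥0∞) (hm : ∀ Q ∈ L, ∀ x ∈ Q, avg μ ν Q ≤ m x) :
    ∑ R ∈ L, ν R ≤ 4 * Λ * ∫⁻ x in A, m x ∂μ := by
  classical
  obtain ⟨S, hS⟩ := exists_isStopping L (avg μ ν) 2
  have hSlam := h.toIsLaminar.mono hS.subset
  have hmS : ∀ F ∈ S, MeasurableSet F := fun F hF => h.measurable F (hS.subset hF)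
  have h1 := h.sum_rpow_mul_le_sum_stopping hS (by norm_num) zero_le_one
  simp only [ENNReal.rpow_one] at h1
  -- the remainder of a stopping set carries at least half of its measure
  have h2 : ∀ F ∈ S, avg μ ν F * μ F ≤ 2 * ∫⁻ x in remainder S F, m x ∂μ := by
    intro F hF
    have hFL := hS.subset hF
    rcases eq_or_ne (avg μ ν F) 0 with h0 | h0
    · simp [h0]
    have ht : avg μ ν F ≠ ∞ := h.avg_ne_top hFL (hν F hFL)
    have h3 : avg μ ν F * (2 * ∑ R ∈ children S F, μ R) ≤ avg μ ν F * μ F := by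
      calc avg μ ν F * (2 * ∑ R ∈ children S F, μ R)
          = ∑ R ∈ children S F, 2 * avg μ ν F * μ R := by rw [← Finset.mul_sum]; ring
        _ ≤ ∑ R ∈ children S F, ν R := by
            refine Finset.sum_le_sum fun R hR => ?_
            rw [mem_children] at hR
            rw [← h.avg_mul ν (hS.subset hR.1)]
            gcongr
            exact ((hS.mem_iff R (hS.subset hR.1)).1 hR.1 F hF hR.2.1).le
        _ ≤ ν F := hSlam.sum_measure_children_le hmS ν F
        _ = avg μ ν F * μ F := (h.avg_mul ν hFL).symm
    have h4 := (ENNReal.mul_le_mul_iff_right h0 ht).1 h3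
    have h5 : μ F = μ (remainder S F) + ∑ R ∈ children S F, μ R := by
      simpa using hSlam.setLIntegral_eq hmS μ (fun _ => 1) F
    have h6 : μ F ≤ 2 * μ (remainder S F) := by
      refine ENNReal.le_two_mul_of_le_add_half (h.ne_top F hFL) ?_
      nth_rw 1 [h5]
      gcongr
      calc ∑ R ∈ children S F, μ R = 2⁻¹ * (2 * ∑ R ∈ children S F, μ R) := by
            rw [← mul_assoc, ENNReal.inv_mul_cancel (by norm_num) (by norm_num), one_mul]
        _ ≤ _ := by gcongr
    calc avg μ ν F * μ F ≤ avg μ ν F * (2 * μ (remainder S F)) := by gcongr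
      _ = 2 * ∫⁻ _ in remainder S F, avg μ ν F ∂μ := by rw [setLIntegral_const]; ring
      _ ≤ 2 * ∫⁻ x in remainder S F, m x ∂μ := by
          gcongr 2 * ?_
          exact setLIntegral_mono' (measurableSet_remainder hmS hF)
            fun x hx => hm F hFL x (remainder_subset S F hx)
  calc ∑ R ∈ L, ν R = ∑ R ∈ L, avg μ ν R * μ R :=
        Finset.sum_congr rfl fun R hR => (h.avg_mul ν hR).symm
    _ ≤ 2 * Λ * ∑ F ∈ S, avg μ ν F * μ F := h1
    _ ≤ 2 * Λ * ∑ F ∈ S, 2 * ∫⁻ x in remainder S F, m x ∂μ := by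
        exact mul_le_mul' le_rfl (Finset.sum_le_sum h2)
    _ = 4 * Λ * ∑ F ∈ S, ∫⁻ x in remainder S F, m x ∂μ := by
        rw [← Finset.mul_sum]; ring
    _ ≤ 4 * Λ * ∫⁻ x in ⋃ F ∈ S, F, m x ∂μ := by
        gcongr
        exact hSlam.sum_setLIntegral_remainder_le hmS μ m
    _ ≤ _ := by
        gcongr
        exact iUnion₂_subset fun F hF => hA F (hS.subset hF)

end Carleson

/-! ### Positive dyadic sums and the testing condition -/

section Testing

variable {X : Type*}

open Classical in
/-- The sets of the family `L` contained in `Q`. -/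
noncomputable def below (L : Finset (Set X)) (Q : Set X) : Finset (Set X) := L.filter (· ⊆ Q)

lemma mem_below {L : Finset (Set X)} {Q R : Set X} : R ∈ below L Q ↔ R ∈ L ∧ R ⊆ Q := by
  simp [below]

lemma below_subset (L : Finset (Set X)) (Q : Set X) : below L Q ⊆ L :=
  fun _ hR => (mem_below.1 hR).1

lemma below_below {L : Finset (Set X)} {Q R : Set X} (h : R ⊆ Q) :
    below (below L Q) R = below L R := by
  ext G
  simp only [mem_below]
  exact ⟨fun hG => ⟨hG.1.1, hG.2⟩, fun hG => ⟨⟨hG.1, hG.2.trans h⟩, hG.2⟩⟩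

/-- The function `∑_{Q ∈ L} c_Q 1_Q`. -/
noncomputable def stepSum (L : Finset (Set X)) (c : Set X → ℝ≥0∞) (x : X) : ℝ≥0∞ :=
  ∑ Q ∈ L, Q.indicator (fun _ => c Q) x

lemma ENNReal.add_rpow_le_add_mul {p : ℝ} (hp : 1 ≤ p) (u v : ℝ≥0∞) :
    (u + v) ^ p ≤ u ^ p + ENNReal.ofReal p * v * (u + v) ^ (p - 1) := by
  have hp0 : 0 < p := by linarith
  rcases eq_or_ne u ∞ with rfl | hu
  · simp [hp0]
  rcases eq_or_ne v ∞ with rfl | hv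
  · have h1 : (∞ : ℝ≥0∞) ^ (p - 1) ≠ 0 := by
      simp [ENNReal.rpow_eq_zero_iff]; linarith
    have h2 : ENNReal.ofReal p ≠ 0 := by simpa using hp0
    simp [ENNReal.mul_top h2, ENNReal.top_mul h1]
  lift u to ℝ≥0 using hu
  lift v to ℝ≥0 using hv
  have hpc : ENNReal.ofReal p = ((Real.toNNReal p : ℝ≥0) : ℝ≥0∞) := rfl
  rw [hpc, ← ENNReal.coe_add, ← ENNReal.coe_rpow_of_nonneg _ hp0.le,
    ← ENNReal.coe_rpow_of_nonneg _ hp0.le, ← ENNReal.coe_rpow_of_nonneg _ (by linarith),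
    ← ENNReal.coe_mul, ← ENNReal.coe_mul, ← ENNReal.coe_add, ENNReal.coe_le_coe,
    ← NNReal.coe_le_coe]
  push_cast
  rw [Real.coe_toNNReal _ hp0.le]
  have hu := u.coe_nonneg
  have hv := v.coe_nonneg
  generalize (u : ℝ) = u at *
  generalize (v : ℝ) = v at *
  rcases (add_nonneg hu hv).eq_or_lt with h0 | h0
  · have : v = 0 := by linarith
    have : u = 0 := by linarith
    subst_vars
    simp
  have h1 := one_add_mul_self_le_rpow_one_add (s := -(v / (u + v)))
    (by rw [neg_le_neg_iff, div_le_one h0]; linarith) hp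
  have h2 : 1 + -(v / (u + v)) = u / (u + v) := by field_simp; ring
  rw [h2, Real.div_rpow hu h0.le, le_div_iff₀ (Real.rpow_pos_of_pos h0 _)] at h1
  have h3 : (u + v) ^ p = (u + v) ^ (p - 1) * (u + v) := by
    conv_lhs => rw [show p = (p - 1) + 1 by ring, Real.rpow_add h0, Real.rpow_one]
  have h4 : (1 + p * -(v / (u + v))) * (u + v) ^ p =
      (u + v) ^ p - p * v * (u + v) ^ (p - 1) := by
    rw [add_mul, h3]; field_simp; ring
  rw [h4] at h1
  linarith

/-- Summation by parts along the chain of sets containing `x`. -/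
lemma IsLaminar.stepSum_rpow_le {L : Finset (Set X)} (h : IsLaminar L) (c : Set X → ℝ≥0∞)
    {p : ℝ} (hp : 1 ≤ p) (x : X) :
    stepSum L c x ^ p ≤ ENNReal.ofReal p *
      ∑ Q ∈ L, Q.indicator (fun y => c Q * stepSum (below L Q) c y ^ (p - 1)) x := by
  classical
  have hp0 : 0 < p := by linarith
  induction hn : L.card generalizing L with
  | zero =>
    rw [Finset.card_eq_zero] at hn
    subst hn
    simp [stepSum, hp0]
  | succ n ih =>
    obtain ⟨R, hR⟩ := L.exists_maximal (by rw [← Finset.card_pos]; omega)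
    have hRL := hR.1
    have hbelow : ∀ Q ∈ L.erase R, below (L.erase R) Q = below L Q := by
      intro Q hQ
      ext G
      simp only [mem_below, Finset.mem_erase]
      refine ⟨fun hG => ⟨hG.1.2, hG.2⟩, fun hG => ⟨⟨?_, hG.1⟩, hG.2⟩⟩
      rintro rfl
      rw [Finset.mem_erase] at hQ
      exact hQ.1 ((hR.2 hQ.2 hG.2).antisymm hG.2)
    have h1 := ih (h.mono (L.erase_subset R)) (by rw [Finset.card_erase_of_mem hRL]; omega)
    have h2 : stepSum L c x = stepSum (L.erase R) c x + R.indicator (fun _ => c R) x := by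
      rw [stepSum, stepSum, Finset.sum_erase_add _ _ hRL]
    rw [← Finset.sum_erase_add _ _ hRL, mul_add]
    rw [Finset.sum_congr rfl fun Q hQ => by rw [hbelow Q hQ]] at h1
    by_cases hx : x ∈ R
    · have h3 : stepSum (below L R) c x = stepSum L c x := by
        refine Finset.sum_subset (below_subset L R) fun G hG hGR => ?_
        refine indicator_of_notMem (fun hxG => hGR (mem_below.2 ⟨hG, ?_⟩)) _
        rcases h.comparable (R := {x}) (singleton_nonempty x) hG hRL (by simpa using hxG)
          (by simpa using hx) with h4 | h4
        · exact h4
        · exact hR.2 hG h4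
      rw [indicator_of_mem hx, h3, h2, indicator_of_mem hx, ← mul_assoc]
      exact (ENNReal.add_rpow_le_add_mul hp _ _).trans (by gcongr)
    · rw [indicator_of_notMem hx, h2, indicator_of_notMem hx]
      simpa using h1

variable [MeasurableSpace X]

lemma measurable_stepSum {L : Finset (Set X)} (hm : ∀ Q ∈ L, MeasurableSet Q)
    (c : Set X → ℝ≥0∞) : Measurable (stepSum L c) :=
  Finset.measurable_sum _ fun Q hQ => measurable_const.indicator (hm Q hQ)

lemma lintegral_stepSum_mul {L : Finset (Set X)} (hm : ∀ Q ∈ L, MeasurableSet Q)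
    (c : Set X → ℝ≥0∞) (ν : Measure X) {g : X → ℝ≥0∞} (hg : Measurable g) :
    ∫⁻ x, stepSum L c x * g x ∂ν = ∑ Q ∈ L, c Q * ∫⁻ x in Q, g x ∂ν := by
  simp only [stepSum, Finset.sum_mul]
  have hm' : ∀ Q ∈ L, AEMeasurable (fun x => Q.indicator (fun _ => c Q) x * g x) ν :=
    fun Q hQ => ((measurable_const.indicator (hm Q hQ)).mul hg).aemeasurable
  rw [lintegral_finsetSum' _ hm']
  refine Finset.sum_congr rfl fun Q hQ => ?_
  rw [← lintegral_const_mul _ hg, ← lintegral_indicator (hm Q hQ)]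
  refine lintegral_congr fun x => ?_
  by_cases hx : x ∈ Q <;> simp [hx]

lemma lintegral_stepSum {L : Finset (Set X)} (hm : ∀ Q ∈ L, MeasurableSet Q)
    (c : Set X → ℝ≥0∞) (ν : Measure X) :
    ∫⁻ x, stepSum L c x ∂ν = ∑ Q ∈ L, c Q * ν Q := by
  simpa using lintegral_stepSum_mul hm c ν (g := fun _ => 1) measurable_const

lemma IsCarleson.lintegral_stepSum_rpow_le {μ : Measure X} {L : Finset (Set X)} {Λ : ℝ≥0∞}
    (h : IsCarleson μ L Λ) (c : Set X → ℝ≥0∞) {p : ℝ} (hp : 1 ≤ p) (ν : Measure X) :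
    ∫⁻ x, stepSum L c x ^ p ∂ν ≤ ENNReal.ofReal p *
      ∑ Q ∈ L, c Q * ∫⁻ x in Q, stepSum (below L Q) c x ^ (p - 1) ∂ν := by
  have hmeas : ∀ Q ∈ L, Measurable fun x => stepSum (below L Q) c x ^ (p - 1) := fun Q _ =>
    (measurable_stepSum (fun R hR => h.measurable R (below_subset L Q hR)) c).pow_const _
  refine (lintegral_mono fun x => h.toIsLaminar.stepSum_rpow_le c hp x).trans ?_
  have hm2 : ∀ Q ∈ L, Measurable fun x =>
      Q.indicator (fun y => c Q * stepSum (below L Q) c y ^ (p - 1)) x := fun Q hQ =>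
    ((hmeas Q hQ).const_mul (c Q)).indicator (h.measurable Q hQ)
  rw [lintegral_const_mul _ (Finset.measurable_sum _ hm2),
    lintegral_finsetSum' _ fun Q hQ => (hm2 Q hQ).aemeasurable]
  refine le_of_eq ?_
  congr 1
  refine Finset.sum_congr rfl fun Q hQ => ?_
  rw [lintegral_indicator (h.measurable Q hQ), lintegral_const_mul _ (hmeas Q hQ)]

lemma setLIntegral_rpow_le_of_le_one {ν : Measure X} {f : X → ℝ≥0∞} (hf : Measurable f)
    {r : ℝ} (hr : 0 ≤ r) (hr1 : r ≤ 1) (Q : Set X) :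
    ∫⁻ x in Q, f x ^ r ∂ν ≤ (∫⁻ x in Q, f x ∂ν) ^ r * ν Q ^ (1 - r) := by
  have := ENNReal.lintegral_mul_norm_pow_le (μ := ν.restrict Q) (p := r) (q := 1 - r)
    (f := f) (g := fun _ => 1) hf.aemeasurable aemeasurable_const hr (by linarith) (by ring)
  simpa using this

lemma IsCarleson.setLIntegral_stepSum_below {μ : Measure X} {L : Finset (Set X)} {Λ : ℝ≥0∞}
    (h : IsCarleson μ L Λ) (c : Set X → ℝ≥0∞) (ν : Measure X) {Q : Set X} :
    ∫⁻ x in Q, stepSum (below L Q) c x ∂ν ≤ ∑ R ∈ below L Q, c R * (avg μ ν R * μ R) := by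
  rw [lintegral_stepSum (fun R hR => h.measurable R (below_subset L Q hR))]
  gcongr with R hR
  rw [h.avg_mul ν (below_subset L Q hR)]
  exact Measure.restrict_apply_le Q R

lemma IsCarleson.setLIntegral_stepSum_rpow_le {μ : Measure X} {L : Finset (Set X)} {Λ : ℝ≥0∞}
    (h : IsCarleson μ L Λ) (c : Set X → ℝ≥0∞) {p : ℝ} (hp : 1 ≤ p) (ν : Measure X) (Q : Set X) :
    ∫⁻ x in Q, stepSum (below L Q) c x ^ p ∂ν ≤ ENNReal.ofReal p *
      ∑ R ∈ below L Q, c R * ∫⁻ x in R, stepSum (below L R) c x ^ (p - 1) ∂ν := by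
  refine ((h.mono (below_subset L Q)).lintegral_stepSum_rpow_le c hp _).trans ?_
  refine mul_le_mul' le_rfl (Finset.sum_le_sum fun R hR => ?_)
  rw [below_below (mem_below.1 hR).2]
  gcongr
  exact Measure.restrict_le_self

/-- Moments of order at most `1 / c`, for a density which is controlled by a negative power of
the averages of `ν`. -/
lemma exists_stepSum_moment_le {c : ℝ} (hc : 0 < c) (hc1 : c ≤ 1) (n : ℕ) :
    ∀ r : ℝ, 0 < r → c * r ≤ 1 → r ≤ n + 1 → ∃ C : ℝ≥0,
      ∀ (μ ν : Measure X) (L : Finset (Set X)) (Λ D : ℝ≥0∞) (a : Set X → ℝ≥0∞),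
      IsCarleson μ L Λ → (∀ Q ∈ L, ν Q ≠ ∞) → (∀ Q ∈ L, a Q * avg μ ν Q ^ c ≤ D) →
      ∀ Q ∈ L, ∫⁻ x in Q, stepSum (below L Q) a x ^ r ∂ν ≤
        C * (Λ * D) ^ r * (avg μ ν Q ^ (1 - c * r) * μ Q) := by
  have hbase : ∀ r : ℝ, 0 < r → c * r ≤ 1 → r ≤ 1 → ∃ C : ℝ≥0,
      ∀ (μ ν : Measure X) (L : Finset (Set X)) (Λ D : ℝ≥0∞) (a : Set X → ℝ≥0∞),
      IsCarleson μ L Λ → (∀ Q ∈ L, ν Q ≠ ∞) → (∀ Q ∈ L, a Q * avg μ ν Q ^ c ≤ D) →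
      ∀ Q ∈ L, ∫⁻ x in Q, stepSum (below L Q) a x ^ r ∂ν ≤
        C * (Λ * D) ^ r * (avg μ ν Q ^ (1 - c * r) * μ Q) := by
    intro r hr hcr hr1
    have hC : 2 * ((2 : ℝ≥0∞) ^ (1 / (1 - (1 - c)))) ^ (1 - c) ≠ ∞ := by
      refine ENNReal.mul_ne_top (by norm_num) (ENNReal.rpow_ne_top_of_nonneg (by linarith)
        (ENNReal.rpow_ne_top_of_nonneg ?_ (by norm_num)))
      rw [sub_sub_cancel]; positivity
    obtain ⟨C, hC⟩ : ∃ C : ℝ≥0, (C : ℝ≥0∞) = _ := ⟨_, ENNReal.coe_toNNReal hC⟩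
    refine ⟨C ^ r, fun μ ν L Λ D a h hν hD Q hQ => ?_⟩
    set b := avg μ ν Q
    have h1 : ∫⁻ x in Q, stepSum (below L Q) a x ∂ν ≤ C * (Λ * D) * (b ^ (1 - c) * μ Q) := by
      calc ∫⁻ x in Q, stepSum (below L Q) a x ∂ν
          ≤ ∑ R ∈ below L Q, a R * (avg μ ν R * μ R) := h.setLIntegral_stepSum_below a ν
        _ ≤ ∑ R ∈ below L Q, D * (avg μ ν R ^ (1 - c) * μ R) := by
            refine Finset.sum_le_sum fun R hR => ?_
            calc a R * (avg μ ν R * μ R)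
                = a R * avg μ ν R ^ c * (avg μ ν R ^ (1 - c) * μ R) := by
                  rw [mul_assoc, ← mul_assoc (avg μ ν R ^ c),
                    ← ENNReal.rpow_add_of_nonneg _ _ hc.le (by linarith), add_sub_cancel,
                    ENNReal.rpow_one]
              _ ≤ _ := by gcongr; exact hD R (below_subset L Q hR)
        _ = D * ∑ R ∈ below L Q, avg μ ν R ^ (1 - c) * μ R := by rw [Finset.mul_sum]
        _ ≤ D * (2 * ((2 : ℝ≥0∞) ^ (1 / (1 - (1 - c)))) ^ (1 - c) * Λ * (b ^ (1 - c) * μ Q)) := by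
            gcongr
            exact h.sum_avg_rpow_le hν (by linarith) (by linarith) hQ (below_subset L Q)
              fun R hR => (mem_below.1 hR).2
        _ = _ := by rw [← hC]; ring
    have hm := measurable_stepSum (L := below L Q)
      (fun R hR => h.measurable R (below_subset L Q hR)) a
    calc ∫⁻ x in Q, stepSum (below L Q) a x ^ r ∂ν
        ≤ (∫⁻ x in Q, stepSum (below L Q) a x ∂ν) ^ r * ν Q ^ (1 - r) :=
          setLIntegral_rpow_le_of_le_one hm hr.le hr1 Q
      _ ≤ (C * (Λ * D) * (b ^ (1 - c) * μ Q)) ^ r * (b * μ Q) ^ (1 - r) := by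
          rw [h.avg_mul ν hQ]
          gcongr
      _ = C ^ r * (Λ * D) ^ r * ((b ^ ((1 - c) * r) * b ^ (1 - r)) * (μ Q ^ r * μ Q ^ (1 - r))) := by
          rw [ENNReal.mul_rpow_of_nonneg _ _ hr.le, ENNReal.mul_rpow_of_nonneg _ _ hr.le,
            ENNReal.mul_rpow_of_nonneg _ _ hr.le, ENNReal.mul_rpow_of_nonneg _ _ hr.le,
            ENNReal.mul_rpow_of_nonneg b (μ Q) (by linarith : 0 ≤ 1 - r), ← ENNReal.rpow_mul]
          ring
      _ = _ := by
          rw [← ENNReal.rpow_add_of_nonneg _ _ (by nlinarith) (by linarith),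
            ← ENNReal.rpow_add_of_nonneg _ _ hr.le (by linarith),
            show (1 - c) * r + (1 - r) = 1 - c * r by ring, show r + (1 - r) = 1 by ring,
            ENNReal.rpow_one, ENNReal.coe_rpow_of_nonneg _ hr.le]
  induction n with
  | zero => exact fun r hr hcr hrn => hbase r hr hcr (by simpa using hrn)
  | succ n ih =>
    intro r hr hcr hrn
    rcases le_or_gt r 1 with hr1 | hr1
    · exact hbase r hr hcr hr1
    have hcr' : c * (r - 1) ≤ 1 := by nlinarith
    obtain ⟨C₁, hC₁⟩ := ih (r - 1) (by linarith) hcr' (by push_cast at hrn; linarith)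
    have hC : 2 * ((2 : ℝ≥0∞) ^ (1 / (1 - (1 - c * r)))) ^ (1 - c * r) ≠ ∞ := by
      refine ENNReal.mul_ne_top (by norm_num) (ENNReal.rpow_ne_top_of_nonneg (by linarith)
        (ENNReal.rpow_ne_top_of_nonneg ?_ (by norm_num)))
      rw [sub_sub_cancel]; positivity
    obtain ⟨C, hC⟩ : ∃ C : ℝ≥0, (C : ℝ≥0∞) = _ := ⟨_, ENNReal.coe_toNNReal hC⟩
    refine ⟨Real.toNNReal r * C₁ * C, fun μ ν L Λ D a h hν hD Q hQ => ?_⟩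
    set b := avg μ ν Q
    calc ∫⁻ x in Q, stepSum (below L Q) a x ^ r ∂ν
        ≤ ENNReal.ofReal r *
          ∑ R ∈ below L Q, a R * ∫⁻ x in R, stepSum (below L R) a x ^ (r - 1) ∂ν :=
          h.setLIntegral_stepSum_rpow_le a hr1.le ν Q
      _ ≤ ENNReal.ofReal r * ∑ R ∈ below L Q,
            C₁ * (Λ * D) ^ (r - 1) * (D * (avg μ ν R ^ (1 - c * r) * μ R)) := by
          refine mul_le_mul' le_rfl (Finset.sum_le_sum fun R hR => ?_)
          have hRL := below_subset L Q hR
          calc a R * ∫⁻ x in R, stepSum (below L R) a x ^ (r - 1) ∂ν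
              ≤ a R * (C₁ * (Λ * D) ^ (r - 1) * (avg μ ν R ^ (1 - c * (r - 1)) * μ R)) := by
                gcongr
                exact hC₁ μ ν L Λ D a h hν hD R hRL
            _ = C₁ * (Λ * D) ^ (r - 1) *
                  (a R * avg μ ν R ^ c * (avg μ ν R ^ (1 - c * r) * μ R)) := by
                rw [show 1 - c * (r - 1) = c + (1 - c * r) by ring,
                  ENNReal.rpow_add_of_nonneg _ _ hc.le (by linarith)]
                ring
            _ ≤ _ := by gcongr; exact hD R hRL
      _ = ENNReal.ofReal r * (C₁ * (Λ * D) ^ (r - 1) * D) *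
            ∑ R ∈ below L Q, avg μ ν R ^ (1 - c * r) * μ R := by
          rw [← Finset.mul_sum, ← Finset.mul_sum]
          ring
      _ ≤ ENNReal.ofReal r * (C₁ * (Λ * D) ^ (r - 1) * D) *
            (2 * ((2 : ℝ≥0∞) ^ (1 / (1 - (1 - c * r)))) ^ (1 - c * r) * Λ *
              (b ^ (1 - c * r) * μ Q)) := by
          gcongr
          exact h.sum_avg_rpow_le hν (by linarith) (by nlinarith [mul_pos hc hr]) hQ
            (below_subset L Q) fun R hR => (mem_below.1 hR).2
      _ = _ := by
          rw [← hC]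
          have h1 : (Λ * D) ^ r = (Λ * D) ^ (r - 1) * (Λ * D) := by
            conv_lhs => rw [show r = (r - 1) + 1 by ring]
            rw [ENNReal.rpow_add_of_nonneg _ _ (by linarith) zero_le_one, ENNReal.rpow_one]
          rw [h1, ENNReal.ofReal]
          push_cast
          ring

/-- The local estimate behind the testing condition: `B` bounds the two weight characteristic,
raised to the power `p`. For `p < 2` it follows from Jensen's inequality and the averages of the
measure `ν`, for `p ≥ 2` from the moment estimate in terms of the averages of the measure `ω`. -/
lemma exists_local_testing {p : ℝ} (hp : 1 < p) : ∃ C : ℝ≥0,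
    ∀ (μ ν ω : Measure X) (L : Finset (Set X)) (Λ B : ℝ≥0∞),
    IsCarleson μ L Λ → (∀ Q ∈ L, ν Q ≠ ∞) → (∀ Q ∈ L, ω Q ≠ ∞) →
    (∀ Q ∈ L, avg μ ω Q * avg μ ν Q ^ (p - 1) ≤ B) →
    ∀ Q ∈ L, avg μ ν Q * ∫⁻ x in Q, stepSum (below L Q) (avg μ ν) x ^ (p - 1) ∂ω ≤
      C * Λ ^ (p - 1) * B * ν Q := by
  have hp1 : 0 < p - 1 := by linarith
  rcases le_or_gt 2 p with hp2 | hp2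
  · have hcr : 1 / (p - 1) * (p - 1) = 1 := by field_simp
    obtain ⟨n, hn⟩ := exists_nat_ge (p - 1)
    obtain ⟨C, hC⟩ := exists_stepSum_moment_le (X := X) (c := 1 / (p - 1)) (by positivity)
      (by rw [div_le_one hp1]; linarith) n (p - 1) hp1 hcr.le (by linarith)
    refine ⟨C, fun μ ν ω L Λ B h hν hω hB Q hQ => ?_⟩
    have h1 := hC μ ω L Λ (B ^ (1 / (p - 1))) (avg μ ν) h hω (fun R hR => ?_) Q hQ
    · rw [hcr, sub_self, ENNReal.rpow_zero, one_mul, ENNReal.mul_rpow_of_nonneg _ _ hp1.le,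
        ← ENNReal.rpow_mul, hcr, ENNReal.rpow_one] at h1
      calc _ ≤ avg μ ν Q * (C * (Λ ^ (p - 1) * B) * μ Q) := by gcongr
        _ = _ := by rw [← h.avg_mul ν hQ]; ring
    · calc avg μ ν R * avg μ ω R ^ (1 / (p - 1))
          = (avg μ ω R * avg μ ν R ^ (p - 1)) ^ (1 / (p - 1)) := by
            rw [ENNReal.mul_rpow_of_nonneg _ _ (by positivity), ← ENNReal.rpow_mul,
              mul_comm (p - 1), hcr, ENNReal.rpow_one, mul_comm]
        _ ≤ _ := by gcongr; exact hB R hR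
  · have hC : 2 * ((2 : ℝ≥0∞) ^ (1 / (1 - (2 - p)))) ^ (2 - p) ≠ ∞ := by
      refine ENNReal.mul_ne_top (by norm_num) (ENNReal.rpow_ne_top_of_nonneg (by linarith)
        (ENNReal.rpow_ne_top_of_nonneg ?_ (by norm_num)))
      rw [show 1 - (2 - p) = p - 1 by ring]; positivity
    obtain ⟨C, hC⟩ : ∃ C : ℝ≥0, (C : ℝ≥0∞) = _ := ⟨_, ENNReal.coe_toNNReal hC⟩
    refine ⟨C ^ (p - 1), fun μ ν ω L Λ B h hν hω hB Q hQ => ?_⟩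
    set a := avg μ ν Q with ha
    set b := avg μ ω Q with hb
    have h1 : ∫⁻ x in Q, stepSum (below L Q) (avg μ ν) x ∂ω ≤ C * Λ * B * (a ^ (2 - p) * μ Q) := by
      calc ∫⁻ x in Q, stepSum (below L Q) (avg μ ν) x ∂ω
          ≤ ∑ R ∈ below L Q, avg μ ν R * (avg μ ω R * μ R) := h.setLIntegral_stepSum_below _ ω
        _ ≤ ∑ R ∈ below L Q, B * (avg μ ν R ^ (2 - p) * μ R) := by
            refine Finset.sum_le_sum fun R hR => ?_
            calc avg μ ν R * (avg μ ω R * μ R)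
                = avg μ ω R * avg μ ν R ^ (p - 1) * (avg μ ν R ^ (2 - p) * μ R) := by
                  have : avg μ ν R = avg μ ν R ^ (p - 1) * avg μ ν R ^ (2 - p) := by
                    rw [← ENNReal.rpow_add_of_nonneg _ _ hp1.le (by linarith),
                      show p - 1 + (2 - p) = 1 by ring, ENNReal.rpow_one]
                  conv_lhs => rw [this]
                  ring
              _ ≤ _ := by gcongr; exact hB R (below_subset L Q hR)
        _ = B * ∑ R ∈ below L Q, avg μ ν R ^ (2 - p) * μ R := by rw [Finset.mul_sum]
        _ ≤ B * (2 * ((2 : ℝ≥0∞) ^ (1 / (1 - (2 - p)))) ^ (2 - p) * Λ * (a ^ (2 - p) * μ Q)) := by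
            gcongr
            exact h.sum_avg_rpow_le hν (by linarith) (by linarith) hQ (below_subset L Q)
              fun R hR => (mem_below.1 hR).2
        _ = _ := by rw [← hC]; ring
    have hm := measurable_stepSum (L := below L Q)
      (fun R hR => h.measurable R (below_subset L Q hR)) (avg μ ν)
    have h2 : (B : ℝ≥0∞) = B ^ (p - 1) * B ^ (2 - p) := by
      rw [← ENNReal.rpow_add_of_nonneg _ _ hp1.le (by linarith),
        show p - 1 + (2 - p) = 1 by ring, ENNReal.rpow_one]
    have h3 : μ Q = μ Q ^ (p - 1) * μ Q ^ (2 - p) := by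
      rw [← ENNReal.rpow_add_of_nonneg _ _ hp1.le (by linarith),
        show p - 1 + (2 - p) = 1 by ring, ENNReal.rpow_one]
    calc a * ∫⁻ x in Q, stepSum (below L Q) (avg μ ν) x ^ (p - 1) ∂ω
        ≤ a * ((∫⁻ x in Q, stepSum (below L Q) (avg μ ν) x ∂ω) ^ (p - 1) *
            ω Q ^ (1 - (p - 1))) := by
          gcongr
          exact setLIntegral_rpow_le_of_le_one hm hp1.le (by linarith) Q
      _ ≤ a * ((C * Λ * B * (a ^ (2 - p) * μ Q)) ^ (p - 1) * (b * μ Q) ^ (2 - p)) := by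
          rw [h.avg_mul ω hQ, show 1 - (p - 1) = 2 - p by ring]
          gcongr
      _ = a * (C ^ (p - 1) * Λ ^ (p - 1) * B ^ (p - 1) * (b * a ^ (p - 1)) ^ (2 - p)
            * (μ Q ^ (p - 1) * μ Q ^ (2 - p))) := by
          have e : (a ^ (2 - p)) ^ (p - 1) = (a ^ (p - 1)) ^ (2 - p) := by
            rw [← ENNReal.rpow_mul, ← ENNReal.rpow_mul, mul_comm]
          have h2p : 0 ≤ 2 - p := by linarith
          simp only [ENNReal.mul_rpow_of_nonneg _ _ hp1.le, ENNReal.mul_rpow_of_nonneg _ _ h2p, e]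
          ring
      _ ≤ a * (C ^ (p - 1) * Λ ^ (p - 1) * B ^ (p - 1) * B ^ (2 - p)
            * (μ Q ^ (p - 1) * μ Q ^ (2 - p))) := by
          have h2p : 0 ≤ 2 - p := by linarith
          gcongr
          exact hB Q hQ
      _ = _ := by
          rw [← h3, mul_assoc _ (B ^ (p - 1)), ← h2, ← h.avg_mul ν hQ,
            ENNReal.coe_rpow_of_nonneg _ hp1.le]
          ring

/-- The testing condition, in terms of the Carleson constant `K` of the family with respect to
the measure `ν`. -/
lemma exists_testing {p : ℝ} (hp : 1 < p) : ∃ C : ℝ≥0,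
    ∀ (μ ν ω : Measure X) (L : Finset (Set X)) (Λ B K : ℝ≥0∞),
    IsCarleson μ L Λ → (∀ Q ∈ L, ν Q ≠ ∞) → (∀ Q ∈ L, ω Q ≠ ∞) →
    (∀ Q ∈ L, avg μ ω Q * avg μ ν Q ^ (p - 1) ≤ B) →
    (∀ Q ∈ L, ∑ R ∈ below L Q, ν R ≤ K * ν Q) →
    ∀ Q ∈ L, ∀ J ⊆ below L Q,
      ∫⁻ x, stepSum J (avg μ ν) x ^ p ∂ω ≤ C * Λ ^ (p - 1) * B * K * ν Q := by
  obtain ⟨C, hC⟩ := exists_local_testing (X := X) hp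
  refine ⟨Real.toNNReal p * C, fun μ ν ω L Λ B K h hν hω hB hK Q hQ J hJ => ?_⟩
  have hJL : J ⊆ L := hJ.trans (below_subset L Q)
  calc ∫⁻ x, stepSum J (avg μ ν) x ^ p ∂ω
      ≤ ENNReal.ofReal p * ∑ R ∈ J,
          avg μ ν R * ∫⁻ x in R, stepSum (below J R) (avg μ ν) x ^ (p - 1) ∂ω :=
        (h.mono hJL).lintegral_stepSum_rpow_le _ hp.le ω
    _ ≤ ENNReal.ofReal p * ∑ R ∈ J, C * Λ ^ (p - 1) * B * ν R := by
        refine mul_le_mul' le_rfl (Finset.sum_le_sum fun R hR => ?_)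
        exact hC μ ν ω J Λ B (h.mono hJL) (fun R hR => hν R (hJL hR)) (fun R hR => hω R (hJL hR))
          (fun R hR => hB R (hJL hR)) R hR
    _ = ENNReal.ofReal p * (C * Λ ^ (p - 1) * B) * ∑ R ∈ J, ν R := by
        rw [← Finset.mul_sum]
        ring
    _ ≤ ENNReal.ofReal p * (C * Λ ^ (p - 1) * B) * ∑ R ∈ below L Q, ν R := by gcongr
    _ ≤ ENNReal.ofReal p * (C * Λ ^ (p - 1) * B) * (K * ν Q) := by
        gcongr
        exact hK Q hQ
    _ = _ := by
        rw [ENNReal.ofReal]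
        push_cast
        ring

end Testing

/-! ### The strong-type bound for finite families -/

section Strong

variable {X : Type*} [MeasurableSpace X]

/-- The average of `g` over `Q` with respect to `ν`; it is `0` if `ν Q = 0`. -/
noncomputable def gavg (ν : Measure X) (g : X → ℝ≥0∞) (Q : Set X) : ℝ≥0∞ :=
  (∫⁻ x in Q, g x ∂ν) / ν Q

lemma gavg_mul {ν : Measure X} (g : X → ℝ≥0∞) {Q : Set X} (hν : ν Q ≠ ∞) :
    gavg ν g Q * ν Q = ∫⁻ x in Q, g x ∂ν := by
  rcases eq_or_ne (ν Q) 0 with h0 | h0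
  · rw [h0, mul_zero, setLIntegral_measure_zero Q g h0]
  · exact ENNReal.div_mul_cancel h0 hν

lemma gavg_ne_top {ν : Measure X} {g : X → ℝ≥0∞} {Q : Set X} (hg : ∫⁻ x in Q, g x ∂ν ≠ ∞) :
    gavg ν g Q ≠ ∞ := by
  rcases eq_or_ne (ν Q) 0 with h0 | h0
  · simp [gavg, setLIntegral_measure_zero Q g h0]
  · exact ENNReal.div_ne_top hg h0

lemma setLIntegral_rpow_le {ν : Measure X} {g : X → ℝ≥0∞} (hg : Measurable g) {p : ℝ}
    (hp : 1 ≤ p) (E : Set X) :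
    (∫⁻ x in E, g x ∂ν) ^ p ≤ ν E ^ (p - 1) * ∫⁻ x in E, g x ^ p ∂ν := by
  have hp0 : 0 < p := by linarith
  have h1 := setLIntegral_rpow_le_of_le_one (ν := ν) (hg.pow_const p) (r := 1 / p) (by positivity)
    (by rw [div_le_one hp0]; exact hp) E
  simp only [← ENNReal.rpow_mul, mul_one_div_cancel hp0.ne', ENNReal.rpow_one] at h1
  calc (∫⁻ x in E, g x ∂ν) ^ p
      ≤ ((∫⁻ x in E, g x ^ p ∂ν) ^ (1 / p) * ν E ^ (1 - 1 / p)) ^ p := by gcongr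
    _ = _ := by
      rw [ENNReal.mul_rpow_of_nonneg _ _ hp0.le, ← ENNReal.rpow_mul, ← ENNReal.rpow_mul,
        one_div_mul_cancel hp0.ne', ENNReal.rpow_one, mul_comm]
      congr 2
      field_simp

/-- The Carleson embedding theorem for the stopping sets of the averages of `g`. -/
lemma IsStopping.sum_gavg_rpow_le {L S : Finset (Set X)} {ν : Measure X} {g : X → ℝ≥0∞} {p : ℝ}
    (hp : 1 < p) (hS : IsStopping L S (gavg ν g) (4 ^ (1 / (p - 1)))) (hL : IsLaminar L)
    (hm : ∀ Q ∈ L, MeasurableSet Q) (hν : ∀ Q ∈ L, ν Q ≠ ∞)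
    (hfin : ∀ Q ∈ L, ∫⁻ x in Q, g x ∂ν ≠ ∞) (hg : Measurable g) :
    ∑ F ∈ S, gavg ν g F ^ p * ν F ≤ 2 * (2 ^ p * ∫⁻ x, g x ^ p ∂ν) := by
  have hp1 : 0 < p - 1 := by linarith
  have hp0 : 0 < p := by linarith
  have hSlam := hL.mono hS.subset
  have hmS : ∀ F ∈ S, MeasurableSet F := fun F hF => hm F (hS.subset hF)
  have hsplit : ∀ y : ℝ≥0∞, y ^ p = y ^ (p - 1) * y := fun y => by
    conv_lhs => rw [show p = (p - 1) + 1 by ring]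
    rw [ENNReal.rpow_add_of_nonneg _ _ hp1.le zero_le_one, ENNReal.rpow_one]
  -- either half of the integral of `g` over `F` comes from the remainder, or the children, on
  -- which the averages are much larger, have at least twice the energy of `F`
  have hstep : ∀ F ∈ S, gavg ν g F ^ p * ν F ≤ 2 ^ p * ∫⁻ x in remainder S F, g x ^ p ∂ν +
      2⁻¹ * ∑ R ∈ children S F, gavg ν g R ^ p * ν R := by
    intro F hF
    have hFL := hS.subset hF
    have hdec := hSlam.setLIntegral_eq hmS ν g F
    rcases le_total (∑ R ∈ children S F, ∫⁻ x in R, g x ∂ν) (∫⁻ x in remainder S F, g x ∂ν)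
      with hcase | hcase
    · refine le_add_right ?_
      rcases eq_or_ne (ν F) 0 with h0 | h0
      · simp [h0]
      have h1 : ν F ^ (p - 1) * (gavg ν g F ^ p * ν F) ≤
          ν F ^ (p - 1) * (2 ^ p * ∫⁻ x in remainder S F, g x ^ p ∂ν) := by
        calc ν F ^ (p - 1) * (gavg ν g F ^ p * ν F) = (gavg ν g F * ν F) ^ p := by
              rw [ENNReal.mul_rpow_of_nonneg _ _ hp0.le, hsplit (ν F)]; ring
          _ ≤ (2 * ∫⁻ x in remainder S F, g x ∂ν) ^ p := by
              rw [gavg_mul g (hν F hFL), hdec, two_mul]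
              gcongr
          _ ≤ 2 ^ p * (ν (remainder S F) ^ (p - 1) * ∫⁻ x in remainder S F, g x ^ p ∂ν) := by
              rw [ENNReal.mul_rpow_of_nonneg _ _ hp0.le]
              gcongr
              exact setLIntegral_rpow_le hg hp.le _
          _ ≤ 2 ^ p * (ν F ^ (p - 1) * ∫⁻ x in remainder S F, g x ^ p ∂ν) := by
              gcongr
              exact remainder_subset S F
          _ = _ := by ring
      exact (ENNReal.mul_le_mul_iff_right (by simp [ENNReal.rpow_eq_zero_iff, h0, hν F hFL])
        (by simp [ENNReal.rpow_eq_top_iff, h0, hν F hFL])).1 h1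
    · refine le_add_left ?_
      have h4 : (2 : ℝ≥0∞) = 2⁻¹ * 4 := by
        rw [show (4 : ℝ≥0∞) = 2 * 2 by norm_num, ← mul_assoc,
          ENNReal.inv_mul_cancel (by norm_num) (by norm_num), one_mul]
      calc gavg ν g F ^ p * ν F = gavg ν g F ^ (p - 1) * (gavg ν g F * ν F) := by
            rw [hsplit, mul_assoc]
        _ ≤ gavg ν g F ^ (p - 1) * (2 * ∑ R ∈ children S F, ∫⁻ x in R, g x ∂ν) := by
            rw [gavg_mul g (hν F hFL), hdec, two_mul]
            gcongr
        _ = 2⁻¹ * ∑ R ∈ children S F,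
              (4 ^ (1 / (p - 1)) * gavg ν g F) ^ (p - 1) * ∫⁻ x in R, g x ∂ν := by
            rw [ENNReal.mul_rpow_of_nonneg _ _ hp1.le, ← ENNReal.rpow_mul,
              one_div_mul_cancel hp1.ne', ENNReal.rpow_one, ← Finset.mul_sum]
            nth_rw 1 [h4]
            ring
        _ ≤ 2⁻¹ * ∑ R ∈ children S F, gavg ν g R ^ p * ν R := by
            refine mul_le_mul' le_rfl (Finset.sum_le_sum fun R hR => ?_)
            rw [mem_children] at hR
            rw [hsplit (gavg ν g R), mul_assoc, gavg_mul g (hν R (hS.subset hR.1))]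
            gcongr
            exact ((hS.mem_iff R (hS.subset hR.1)).1 hR.1 F hF hR.2.1).le
  have hXfin : ∑ F ∈ S, gavg ν g F ^ p * ν F ≠ ∞ :=
    ENNReal.sum_ne_top.2 fun F hF => ENNReal.mul_ne_top
      (ENNReal.rpow_ne_top_of_nonneg hp0.le (gavg_ne_top (hfin F (hS.subset hF))))
      (hν F (hS.subset hF))
  refine ENNReal.le_two_mul_of_le_add_half hXfin ?_
  calc ∑ F ∈ S, gavg ν g F ^ p * ν F
      ≤ ∑ F ∈ S, (2 ^ p * ∫⁻ x in remainder S F, g x ^ p ∂ν +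
          2⁻¹ * ∑ R ∈ children S F, gavg ν g R ^ p * ν R) := Finset.sum_le_sum hstep
    _ = 2 ^ p * ∑ F ∈ S, ∫⁻ x in remainder S F, g x ^ p ∂ν +
          2⁻¹ * ∑ F ∈ S, ∑ R ∈ children S F, gavg ν g R ^ p * ν R := by
        rw [Finset.sum_add_distrib, Finset.mul_sum, Finset.mul_sum]
    _ ≤ _ := by
        refine add_le_add (mul_le_mul' le_rfl ?_) (mul_le_mul' le_rfl ?_)
        · exact (hSlam.sum_setLIntegral_remainder_le hmS ν _).trans
            (setLIntegral_le_lintegral _ _)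
        · exact sum_children_le S fun R => gavg ν g R ^ p * ν R

/-- The function that equals `h` on the remainder of `F` and is replaced by its averages on the
children of `F`. -/
noncomputable def averaged (S : Finset (Set X)) (ω : Measure X) (h : X → ℝ≥0∞) (F : Set X)
    (x : X) : ℝ≥0∞ :=
  (remainder S F).indicator h x + stepSum (children S F) (gavg ω h) x

lemma measurable_averaged {S : Finset (Set X)} (hm : ∀ Q ∈ S, MeasurableSet Q) (ω : Measure X)
    {h : X → ℝ≥0∞} (hh : Measurable h) {F : Set X} (hF : F ∈ S) :
    Measurable (averaged S ω h F) :=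
  (hh.indicator (measurableSet_remainder hm hF)).add
    (measurable_stepSum (fun R hR => hm R (mem_children.1 hR).1) _)

lemma IsLaminar.averaged_rpow {S : Finset (Set X)} (hS : IsLaminar S) (ω : Measure X)
    (h : X → ℝ≥0∞) (F : Set X) {q : ℝ} (hq : 0 < q) (x : X) :
    averaged S ω h F x ^ q = (remainder S F).indicator (fun y => h y ^ q) x +
      stepSum (children S F) (fun R => gavg ω h R ^ q) x := by
  by_cases hx : ∃ R ∈ children S F, x ∈ R
  · obtain ⟨R, hR, hxR⟩ := hx
    have hrem : x ∉ remainder S F := fun hx => hx.2 (mem_biUnion hR hxR)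
    have hstep : ∀ c : Set X → ℝ≥0∞, stepSum (children S F) c x = c R := by
      intro c
      rw [stepSum, Finset.sum_eq_single_of_mem R hR fun R' hR' hne => ?_, indicator_of_mem hxR]
      exact indicator_of_notMem
        (fun hxR' => Set.disjoint_left.1 (hS.children_disjoint F hR' hR hne) hxR' hxR) _
    simp [averaged, hstep, indicator_of_notMem hrem]
  · push Not at hx
    have hstep : ∀ c : Set X → ℝ≥0∞, stepSum (children S F) c x = 0 := fun c =>
      Finset.sum_eq_zero fun R hR => indicator_of_notMem (hx R hR) _
    by_cases hrem : x ∈ remainder S F <;> simp [averaged, hstep, hrem, hq]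

/-- A set projected to `F` does not see the averaging over the children of `F`. -/
lemma IsLaminar.setLIntegral_averaged {L S : Finset (Set X)} (hL : IsLaminar L) (hS : S ⊆ L)
    (hm : ∀ Q ∈ L, MeasurableSet Q) {ω : Measure X} (hω : ∀ Q ∈ L, ω Q ≠ ∞) {h : X → ℝ≥0∞}
    (hh : Measurable h) {Q F : Set X} (hQ : Q ∈ L) (hF : F ∈ S) (hQF : Q ⊆ F)
    (hmin : ∀ G ∈ S, Q ⊆ G → F ⊆ G) :
    ∫⁻ x in Q, averaged S ω h F x ∂ω = ∫⁻ x in Q, h x ∂ω := by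
  have hmS : ∀ R ∈ S, MeasurableSet R := fun R hR => hm R (hS hR)
  have hrem := measurableSet_remainder hmS hF
  have h1 := (hL.mono hS).setLIntegral_eq hmS (ω.restrict Q) h F
  rw [Measure.restrict_restrict (hmS F hF), inter_eq_self_of_subset_right hQF] at h1
  simp only [averaged]
  rw [lintegral_add_left (hh.indicator hrem), lintegral_indicator hrem, h1,
    lintegral_stepSum (fun R hR => hmS R (mem_children.1 hR).1)]
  congr 1
  refine Finset.sum_congr rfl fun R hR => ?_
  have hRS := (mem_children.1 hR).1
  rw [Measure.restrict_apply (hmS R hRS), Measure.restrict_restrict (hmS R hRS)]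
  rcases hL.child_subset_or_disjoint hS hQ hmin hR with h2 | h2
  · rw [inter_eq_self_of_subset_left h2, gavg_mul h (hω R (hS hRS))]
  · simp [h2.inter_eq]

lemma ENNReal.rpow_mul_rpow_le_add {p q : ℝ} (hpq : p.HolderConjugate q) (x y : ℝ≥0∞) :
    x ^ (1 / p) * y ^ (1 / q) ≤ x + y := by
  have hp := hpq.one_div_nonneg
  have hq := hpq.symm.one_div_nonneg
  calc x ^ (1 / p) * y ^ (1 / q) ≤ (x + y) ^ (1 / p) * (x + y) ^ (1 / q) := by
        gcongr
        · exact le_self_add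
        · exact le_add_self
    _ = x + y := by
        rw [← ENNReal.rpow_add_of_nonneg _ _ hp hq, one_div, one_div, hpq.inv_add_inv_eq_one,
          ENNReal.rpow_one]

/-- The part of the bilinear form where `g` dominates `h`: testing on the stopping sets of `g`
suffices. -/
lemma IsCarleson.sum_le_of_gavg_le {p q : ℝ} (hpq : p.HolderConjugate q) {μ ν ω : Measure X}
    {L : Finset (Set X)} {Λ θ : ℝ≥0∞} (hL : IsCarleson μ L Λ) (hν : ∀ Q ∈ L, ν Q ≠ ∞)
    (hω : ∀ Q ∈ L, ω Q ≠ ∞) {g h : X → ℝ≥0∞} (hg : Measurable g) (hh : Measurable h)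
    (hgfin : ∀ Q ∈ L, ∫⁻ x in Q, g x ∂ν ≠ ∞)
    (htest : ∀ Q ∈ L, ∀ J ⊆ below L Q, ∫⁻ x, stepSum J (avg μ ν) x ^ p ∂ω ≤ θ * ν Q)
    (hle : ∀ Q ∈ L, gavg ω h Q ^ q * ω Q ≤ gavg ν g Q ^ p * ν Q) :
    ∑ Q ∈ L, (μ Q)⁻¹ * (∫⁻ x in Q, g x ∂ν) * ∫⁻ x in Q, h x ∂ω ≤
      4 ^ (1 / (p - 1)) * θ ^ (1 / p) *
        (2 * (2 * (2 ^ p * ∫⁻ x, g x ^ p ∂ν)) + ∫⁻ x, h x ^ q ∂ω) := by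
  classical
  have hp0 := hpq.pos
  have hq0 := hpq.symm.pos
  have hp1 : 0 < p - 1 := by linarith [hpq.lt]
  set r : ℝ≥0∞ := 4 ^ (1 / (p - 1))
  have hr : 1 ≤ r := ENNReal.one_le_rpow (by norm_num) (by positivity)
  obtain ⟨S, hS⟩ := exists_isStopping L (gavg ν g) r
  have hSlam := hL.toIsLaminar.mono hS.subset
  have hmS : ∀ F ∈ S, MeasurableSet F := fun F hF => hL.measurable F (hS.subset hF)
  have hemb := hS.sum_gavg_rpow_le hpq.lt hL.toIsLaminar hL.measurable hν hgfin hg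
  have hproj := fun R hR => hS.exists_proj hL.toIsLaminar hr (R := R) hR
  choose! π hπS hπ hmin hπle using hproj
  -- the sum over the sets projected to a single stopping set
  have hF : ∀ F ∈ S, gavg ν g F * ∑ Q ∈ L with π Q = F, avg μ ν Q * ∫⁻ x in Q, h x ∂ω ≤
      θ ^ (1 / p) * (gavg ν g F ^ p * ν F + (∫⁻ x in remainder S F, h x ^ q ∂ω +
        ∑ R ∈ children S F, gavg ν g R ^ p * ν R)) := by
    intro F hF
    set J := L.filter (fun Q => π Q = F)
    have hJ : J ⊆ below L F := fun Q hQ => by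
      rw [Finset.mem_filter] at hQ
      exact mem_below.2 ⟨hQ.1, hQ.2 ▸ hπ Q hQ.1⟩
    have hJm : ∀ Q ∈ J, MeasurableSet Q := fun Q hQ =>
      hL.measurable Q (below_subset L F (hJ hQ))
    have hav := measurable_averaged hmS ω hh hF
    have h1 : ∑ Q ∈ J, avg μ ν Q * ∫⁻ x in Q, h x ∂ω =
        ∫⁻ x, stepSum J (avg μ ν) x * averaged S ω h F x ∂ω := by
      rw [lintegral_stepSum_mul hJm _ _ hav]
      refine Finset.sum_congr rfl fun Q hQ => ?_
      rw [Finset.mem_filter] at hQ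
      rw [hL.toIsLaminar.setLIntegral_averaged hS.subset hL.measurable hω hh hQ.1 hF
        (hQ.2 ▸ hπ Q hQ.1) (hQ.2 ▸ hmin Q hQ.1)]
    have h2 : ∫⁻ x, averaged S ω h F x ^ q ∂ω ≤ ∫⁻ x in remainder S F, h x ^ q ∂ω +
        ∑ R ∈ children S F, gavg ν g R ^ p * ν R := by
      simp only [hSlam.averaged_rpow ω h F hq0]
      have hrem := measurableSet_remainder hmS hF
      rw [lintegral_add_left ((hh.pow_const q).indicator hrem), lintegral_indicator hrem,
        lintegral_stepSum (fun R hR => hmS R (mem_children.1 hR).1)]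
      refine add_le_add le_rfl (Finset.sum_le_sum fun R hR => ?_)
      exact hle R (hS.subset (mem_children.1 hR).1)
    calc gavg ν g F * ∑ Q ∈ J, avg μ ν Q * ∫⁻ x in Q, h x ∂ω
        ≤ gavg ν g F * ((∫⁻ x, stepSum J (avg μ ν) x ^ p ∂ω) ^ (1 / p) *
            (∫⁻ x, averaged S ω h F x ^ q ∂ω) ^ (1 / q)) := by
          rw [h1]
          gcongr
          exact ENNReal.lintegral_mul_le_Lp_mul_Lq ω hpq
            (measurable_stepSum hJm _).aemeasurable hav.aemeasurable
      _ ≤ gavg ν g F * ((θ * ν F) ^ (1 / p) * (∫⁻ x in remainder S F, h x ^ q ∂ω +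
            ∑ R ∈ children S F, gavg ν g R ^ p * ν R) ^ (1 / q)) := by
          have hp' := hpq.one_div_nonneg
          have hq' := hpq.symm.one_div_nonneg
          gcongr
          exact htest F (hS.subset hF) J hJ
      _ = θ ^ (1 / p) * ((gavg ν g F ^ p * ν F) ^ (1 / p) *
            (∫⁻ x in remainder S F, h x ^ q ∂ω +
            ∑ R ∈ children S F, gavg ν g R ^ p * ν R) ^ (1 / q)) := by
          rw [ENNReal.mul_rpow_of_nonneg _ _ hpq.one_div_nonneg,
            ENNReal.mul_rpow_of_nonneg _ _ hpq.one_div_nonneg, ← ENNReal.rpow_mul,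
            mul_one_div_cancel hp0.ne', ENNReal.rpow_one]
          ring
      _ ≤ _ := by
          gcongr
          exact ENNReal.rpow_mul_rpow_le_add hpq _ _
  calc ∑ Q ∈ L, (μ Q)⁻¹ * (∫⁻ x in Q, g x ∂ν) * ∫⁻ x in Q, h x ∂ω
      = ∑ Q ∈ L, gavg ν g Q * (avg μ ν Q * ∫⁻ x in Q, h x ∂ω) := by
        refine Finset.sum_congr rfl fun Q hQ => ?_
        rw [← gavg_mul g (hν Q hQ), avg, div_eq_mul_inv]
        ring
    _ = ∑ F ∈ S, ∑ Q ∈ L with π Q = F, gavg ν g Q * (avg μ ν Q * ∫⁻ x in Q, h x ∂ω) :=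
        (Finset.sum_fiberwise_of_maps_to hπS _).symm
    _ ≤ ∑ F ∈ S, r * (θ ^ (1 / p) * (gavg ν g F ^ p * ν F + (∫⁻ x in remainder S F, h x ^ q ∂ω +
          ∑ R ∈ children S F, gavg ν g R ^ p * ν R))) := by
        refine Finset.sum_le_sum fun F hFS => ?_
        refine le_trans ?_ (mul_le_mul' le_rfl (hF F hFS))
        rw [← mul_assoc, Finset.mul_sum]
        refine Finset.sum_le_sum fun Q hQ => ?_
        rw [Finset.mem_filter] at hQ
        gcongr
        exact hQ.2 ▸ hπle Q hQ.1
    _ = r * θ ^ (1 / p) * (∑ F ∈ S, gavg ν g F ^ p * ν F +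
          (∑ F ∈ S, ∫⁻ x in remainder S F, h x ^ q ∂ω +
          ∑ F ∈ S, ∑ R ∈ children S F, gavg ν g R ^ p * ν R)) := by
        rw [← Finset.mul_sum, ← Finset.mul_sum, Finset.sum_add_distrib, Finset.sum_add_distrib,
          mul_assoc]
    _ ≤ r * θ ^ (1 / p) * (2 * (2 ^ p * ∫⁻ x, g x ^ p ∂ν) +
          (∫⁻ x, h x ^ q ∂ω + 2 * (2 ^ p * ∫⁻ x, g x ^ p ∂ν))) := by
        gcongr
        · exact (hSlam.sum_setLIntegral_remainder_le hmS ω _).trans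
            (setLIntegral_le_lintegral _ _)
        · exact (sum_children_le S fun R => gavg ν g R ^ p * ν R).trans hemb
    _ = _ := by ring

/-- The coefficient `|Q|⁻¹ ∫_Q g dν` of the dyadic operator. -/
noncomputable def coef (μ ν : Measure X) (g : X → ℝ≥0∞) (Q : Set X) : ℝ≥0∞ :=
  (μ Q)⁻¹ * ∫⁻ x in Q, g x ∂ν

lemma IsCarleson.coef_ne_top {μ ν : Measure X} {L : Finset (Set X)} {Λ : ℝ≥0∞}
    (hL : IsCarleson μ L Λ) {g : X → ℝ≥0∞} {Q : Set X} (hQ : Q ∈ L)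
    (hg : ∫⁻ x in Q, g x ∂ν ≠ ∞) : coef μ ν g Q ≠ ∞ :=
  ENNReal.mul_ne_top (ENNReal.inv_ne_top.2 (hL.ne_zero Q hQ)) hg

/-- The constant of the two weight inequality in terms of the testing constants. -/
noncomputable def testingConst (p q : ℝ) : ℝ≥0∞ :=
  4 ^ (1 / (p - 1)) * (2 * (2 * 2 ^ p)) + 4 ^ (1 / (q - 1)) * (2 * (2 * 2 ^ q))

lemma testingConst_ne_top {p q : ℝ} (hp : 1 < p) (hq : 1 < q) : testingConst p q ≠ ∞ := by
  have h : ∀ r : ℝ, 1 < r → (4 : ℝ≥0∞) ^ (1 / (r - 1)) * (2 * (2 * 2 ^ r)) ≠ ∞ := by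
    intro r hr
    have hr1 : 0 < r - 1 := by linarith
    have h1 : (4 : ℝ≥0∞) ^ (1 / (r - 1)) ≠ ∞ :=
      ENNReal.rpow_ne_top_of_nonneg (by positivity) (by norm_num)
    have h2 : (2 : ℝ≥0∞) ^ r ≠ ∞ := ENNReal.rpow_ne_top_of_nonneg (by linarith) (by norm_num)
    finiteness
  exact ENNReal.add_ne_top.2 ⟨h p hp, h q hq⟩

lemma ENNReal.one_le_two_mul_two_mul_rpow {p : ℝ} (hp : 0 < p) :
    (1 : ℝ≥0∞) ≤ 2 * (2 * 2 ^ p) :=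
  one_le_mul (by norm_num) (one_le_mul (by norm_num) (ENNReal.one_le_rpow (by norm_num) hp))

/-- The two weight inequality, in dual form, under the two testing conditions. -/
lemma IsCarleson.bilinear_le {p q : ℝ} (hpq : p.HolderConjugate q) {μ ν ω : Measure X}
    {L : Finset (Set X)} {Λ θ η : ℝ≥0∞} (hL : IsCarleson μ L Λ) (hν : ∀ Q ∈ L, ν Q ≠ ∞)
    (hω : ∀ Q ∈ L, ω Q ≠ ∞) {g h : X → ℝ≥0∞} (hg : Measurable g) (hh : Measurable h)
    (hgfin : ∀ Q ∈ L, ∫⁻ x in Q, g x ∂ν ≠ ∞) (hhfin : ∀ Q ∈ L, ∫⁻ x in Q, h x ∂ω ≠ ∞)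
    (htest : ∀ Q ∈ L, ∀ J ⊆ below L Q, ∫⁻ x, stepSum J (avg μ ν) x ^ p ∂ω ≤ θ * ν Q)
    (htest' : ∀ Q ∈ L, ∀ J ⊆ below L Q, ∫⁻ x, stepSum J (avg μ ω) x ^ q ∂ν ≤ η * ω Q) :
    ∫⁻ x, stepSum L (coef μ ν g) x * h x ∂ω ≤
      testingConst p q * (θ ^ (1 / p) + η ^ (1 / q)) *
        (∫⁻ x, g x ^ p ∂ν + ∫⁻ x, h x ^ q ∂ω) := by
  classical
  set L₁ := L.filter fun Q => gavg ω h Q ^ q * ω Q ≤ gavg ν g Q ^ p * ν Q with hL₁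
  set L₂ := L.filter fun Q => ¬ gavg ω h Q ^ q * ω Q ≤ gavg ν g Q ^ p * ν Q with hL₂
  have hs₁ : L₁ ⊆ L := Finset.filter_subset _ _
  have hs₂ : L₂ ⊆ L := Finset.filter_subset _ _
  have hbelow : ∀ {L' : Finset (Set X)} (Q : Set X), L' ⊆ L → below L' Q ⊆ below L Q :=
    fun Q hL' R hR => mem_below.2 ⟨hL' (mem_below.1 hR).1, (mem_below.1 hR).2⟩
  have h1 := (hL.mono hs₁).sum_le_of_gavg_le hpq (fun Q hQ => hν Q (hs₁ hQ))
    (fun Q hQ => hω Q (hs₁ hQ)) hg hh (fun Q hQ => hgfin Q (hs₁ hQ))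
    (fun Q hQ J hJ => htest Q (hs₁ hQ) J (hJ.trans (hbelow Q hs₁)))
    (fun Q hQ => (Finset.mem_filter.1 hQ).2)
  have h2 := (hL.mono hs₂).sum_le_of_gavg_le hpq.symm (fun Q hQ => hω Q (hs₂ hQ))
    (fun Q hQ => hν Q (hs₂ hQ)) hh hg (fun Q hQ => hhfin Q (hs₂ hQ))
    (fun Q hQ J hJ => htest' Q (hs₂ hQ) J (hJ.trans (hbelow Q hs₂)))
    (fun Q hQ => (not_le.1 (Finset.mem_filter.1 hQ).2).le)
  set G := ∫⁻ x, g x ^ p ∂ν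
  set H := ∫⁻ x, h x ^ q ∂ω
  set A : ℝ≥0∞ := 4 ^ (1 / (p - 1))
  set B : ℝ≥0∞ := 4 ^ (1 / (q - 1))
  have hp2 := ENNReal.one_le_two_mul_two_mul_rpow hpq.pos
  have hq2 := ENNReal.one_le_two_mul_two_mul_rpow hpq.symm.pos
  rw [lintegral_stepSum_mul hL.measurable _ _ hh]
  calc ∑ Q ∈ L, coef μ ν g Q * ∫⁻ x in Q, h x ∂ω
      = ∑ Q ∈ L₁, (μ Q)⁻¹ * (∫⁻ x in Q, g x ∂ν) * (∫⁻ x in Q, h x ∂ω) +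
          ∑ Q ∈ L₂, (μ Q)⁻¹ * (∫⁻ x in Q, h x ∂ω) * ∫⁻ x in Q, g x ∂ν := by
        rw [← Finset.sum_filter_add_sum_filter_not L
          (fun Q => gavg ω h Q ^ q * ω Q ≤ gavg ν g Q ^ p * ν Q)]
        congr 1
        refine Finset.sum_congr rfl fun Q _ => ?_
        rw [coef]
        ring
    _ ≤ A * θ ^ (1 / p) * (2 * (2 * (2 ^ p * G)) + H) +
          B * η ^ (1 / q) * (2 * (2 * (2 ^ q * H)) + G) := add_le_add h1 h2
    _ ≤ A * θ ^ (1 / p) * (2 * (2 * (2 ^ p * G)) + 2 * (2 * 2 ^ p) * H) +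
          B * η ^ (1 / q) * (2 * (2 * (2 ^ q * H)) + 2 * (2 * 2 ^ q) * G) := by
        gcongr
        · exact le_mul_of_one_le_left' hp2
        · exact le_mul_of_one_le_left' hq2
    _ = (A * (2 * (2 * 2 ^ p)) * θ ^ (1 / p) + B * (2 * (2 * 2 ^ q)) * η ^ (1 / q)) *
          (G + H) := by ring
    _ ≤ (testingConst p q * θ ^ (1 / p) + testingConst p q * η ^ (1 / q)) * (G + H) := by
        gcongr
        · exact le_self_add
        · exact le_add_self
    _ = _ := by ring

/-- The sum `u = ∑ c_Q 1_Q` is tested against `h = ε u^{p-1}`; a small `ε` allows to absorb the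
term with `h`. -/
lemma IsCarleson.lintegral_stepSum_coef_rpow_le {p q : ℝ} (hpq : p.HolderConjugate q)
    {μ ν ω : Measure X} {L : Finset (Set X)} {Λ θ η : ℝ≥0∞} (hL : IsCarleson μ L Λ)
    (hν : ∀ Q ∈ L, ν Q ≠ ∞) (hω : ∀ Q ∈ L, ω Q ≠ ∞) {g : X → ℝ≥0∞} (hg : Measurable g)
    (hgfin : ∀ Q ∈ L, ∫⁻ x in Q, g x ∂ν ≠ ∞)
    (htest : ∀ Q ∈ L, ∀ J ⊆ below L Q, ∫⁻ x, stepSum J (avg μ ν) x ^ p ∂ω ≤ θ * ν Q)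
    (htest' : ∀ Q ∈ L, ∀ J ⊆ below L Q, ∫⁻ x, stepSum J (avg μ ω) x ^ q ∂ν ≤ η * ω Q) :
    ∫⁻ x, stepSum L (coef μ ν g) x ^ p ∂ω ≤
      (2 * (testingConst p q * (θ ^ (1 / p) + η ^ (1 / q)))) ^ p * ∫⁻ x, g x ^ p ∂ν := by
  have hp0 := hpq.pos
  have hq0 := hpq.symm.pos
  have hp1 : 0 < p - 1 := by linarith [hpq.lt]
  set u := stepSum L (coef μ ν g)
  set K := testingConst p q * (θ ^ (1 / p) + η ^ (1 / q))
  set G := ∫⁻ x, g x ^ p ∂ν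
  rcases eq_or_ne G 0 with hG | hG
  · have hg0 : ∀ᵐ x ∂ν, g x = 0 := by
      filter_upwards [(lintegral_eq_zero_iff (hg.pow_const p)).1 hG] with x hx
      simpa [hp0, hp0.le, hp0.not_gt] using hx
    have hc : ∀ Q, coef μ ν g Q = 0 := fun Q => by
      rw [coef, lintegral_eq_zero_of_ae_eq_zero (ae_restrict_of_ae hg0), mul_zero]
    have hu0 : ∀ x, u x = 0 := fun x => by simp [u, stepSum, hc]
    simp [hu0, hp0]
  rcases eq_or_ne K ∞ with hK | hK
  · simp [hK, hp0, hG, ENNReal.mul_top, ENNReal.top_mul]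
  have hu : Measurable u := measurable_stepSum hL.measurable _
  have hup := hu.pow_const (p - 1)
  have hsplit : ∀ y : ℝ≥0∞, y ^ p = y * y ^ (p - 1) := fun y => by
    conv_lhs => rw [show p = 1 + (p - 1) by ring]
    rw [ENNReal.rpow_add_of_nonneg _ _ zero_le_one hp1.le, ENNReal.rpow_one]
  have hfin : ∀ Q ∈ L, ∫⁻ x in Q, u x ^ (p - 1) ∂ω ≠ ∞ := by
    intro Q hQ
    have hbd : ∀ x, u x ^ (p - 1) ≤ (∑ R ∈ L, coef μ ν g R) ^ (p - 1) := fun x => by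
      gcongr
      exact Finset.sum_le_sum fun R _ => indicator_le_self' (fun _ _ => zero_le) x
    refine ne_top_of_le_ne_top ?_ (setLIntegral_mono' (hL.measurable Q hQ) fun x _ => hbd x)
    rw [setLIntegral_const]
    exact ENNReal.mul_ne_top (ENNReal.rpow_ne_top_of_nonneg hp1.le
      (ENNReal.sum_ne_top.2 fun R hR => hL.coef_ne_top hR (hgfin R hR))) (hω Q hQ)
  have hN : ∫⁻ x, u x ^ p ∂ω ≠ ∞ := by
    simp only [hsplit]
    rw [lintegral_stepSum_mul hL.measurable _ _ hup]
    exact ENNReal.sum_ne_top.2 fun Q hQ =>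
      ENNReal.mul_ne_top (hL.coef_ne_top hQ (hgfin Q hQ)) (hfin Q hQ)
  set N := ∫⁻ x, u x ^ p ∂ω
  have key : ∀ ε : ℝ≥0∞, ε ≠ ∞ → ε * N ≤ K * (G + ε ^ q * N) := by
    intro ε hε
    have h1 := hL.bilinear_le hpq hν hω hg (hup.const_mul ε) hgfin (fun Q hQ => by
      rw [lintegral_const_mul _ hup]
      exact ENNReal.mul_ne_top hε (hfin Q hQ)) htest htest'
    have h2 : ∫⁻ x, u x * (ε * u x ^ (p - 1)) ∂ω = ε * N := by
      rw [← lintegral_const_mul _ (hu.pow_const p)]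
      refine lintegral_congr fun x => ?_
      rw [hsplit]
      ring
    have h3 : ∫⁻ x, (ε * u x ^ (p - 1)) ^ q ∂ω = ε ^ q * N := by
      rw [← lintegral_const_mul _ (hu.pow_const p)]
      refine lintegral_congr fun x => ?_
      rw [ENNReal.mul_rpow_of_nonneg _ _ hq0.le, ← ENNReal.rpow_mul, hpq.sub_one_mul_conj]
    rwa [h2, h3] at h1
  rcases eq_or_ne K 0 with hK0 | hK0
  · have h1 := key 1 (by norm_num)
    rw [hK0, zero_mul, one_mul] at h1
    exact h1.trans zero_le
  have h2K0 : 2 * K ≠ 0 := by simp [hK0]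
  have h2K : 2 * K ≠ ∞ := by finiteness
  -- the choice of `ε` for which `K * ε ^ q = ε / 2`
  set ε : ℝ≥0∞ := (2 * K) ^ (-(p - 1))
  have hε0 : ε ≠ 0 := by simp [ε, ENNReal.rpow_eq_zero_iff, h2K0, h2K]
  have hεt : ε ≠ ∞ := by simp [ε, ENNReal.rpow_eq_top_iff, h2K0, h2K]
  have hε : 2 * K * ε ^ q = ε := by
    rw [← ENNReal.rpow_mul, show -(p - 1) * q = -p by rw [neg_mul, hpq.sub_one_mul_conj]]
    nth_rw 1 [← ENNReal.rpow_one (2 * K)]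
    rw [← ENNReal.rpow_add _ _ h2K0 h2K]
    congr 1
    ring
  have h1 : ε * N ≤ 2 * (K * G) := by
    refine ENNReal.le_two_mul_of_le_add_half (ENNReal.mul_ne_top hεt hN) ?_
    refine (key ε hεt).trans (le_of_eq ?_)
    nth_rw 2 [← hε]
    rw [← mul_assoc 2⁻¹, ← mul_assoc 2⁻¹, ← mul_assoc 2⁻¹,
      ENNReal.inv_mul_cancel (by norm_num) (by norm_num)]
    ring
  have h2 : ε⁻¹ * (2 * K) = (2 * K) ^ p := by
    rw [← ENNReal.rpow_neg, neg_neg]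
    nth_rw 2 [← ENNReal.rpow_one (2 * K)]
    rw [← ENNReal.rpow_add _ _ h2K0 h2K, sub_add_cancel]
  calc N = ε⁻¹ * (ε * N) := by rw [← mul_assoc, ENNReal.inv_mul_cancel hε0 hεt, one_mul]
    _ ≤ ε⁻¹ * (2 * (K * G)) := by gcongr
    _ = (2 * K) ^ p * G := by rw [← h2]; ring

end Strong

/-! ### The weak-type bound for finite families -/

section Weak

variable {X : Type*}

/-- The maximal sets of the superlevel set `{u > t}` of `u = ∑ c_Q 1_Q`: they are disjoint, they
make up the superlevel set, and on them `u` exceeds `t` at most by its local part. -/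
lemma IsLaminar.exists_maximal_superlevel {L : Finset (Set X)} (hL : IsLaminar L)
    (c : Set X → ℝ≥0∞) (t : ℝ≥0∞) : ∃ J ⊆ L, (J : Set (Set X)).PairwiseDisjoint id ∧
      {x | t < stepSum L c x} = ⋃ Q ∈ J, Q ∧
      ∀ Q ∈ J, ∀ x ∈ Q, stepSum L c x ≤ t + stepSum (below L Q) c x := by
  classical
  let s : Set X → ℝ≥0∞ := fun Q => ∑ R ∈ L with Q ⊆ R, c R
  have hle : ∀ Q x, x ∈ Q → s Q ≤ stepSum L c x := by
    intro Q x hx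
    calc s Q = ∑ R ∈ L with Q ⊆ R, R.indicator (fun _ => c R) x := by
          refine Finset.sum_congr rfl fun R hR => ?_
          rw [indicator_of_mem ((Finset.mem_filter.1 hR).2 hx)]
      _ ≤ _ := Finset.sum_le_sum_of_subset (Finset.filter_subset _ _)
  set K := L.filter fun Q => t < s Q
  set J := K.filter fun Q => ∀ R ∈ K, Q ⊆ R → R ⊆ Q
  have hJK : J ⊆ K := Finset.filter_subset _ _
  have hKL : K ⊆ L := Finset.filter_subset _ _
  refine ⟨J, hJK.trans hKL, ?_, ?_, ?_⟩
  · intro Q hQ R hR hne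
    rw [Finset.mem_coe, Finset.mem_filter] at hQ hR
    rcases hL.nested Q (hKL hQ.1) R (hKL hR.1) with h1 | h1 | h1
    · exact h1
    · exact absurd (h1.antisymm (hQ.2 R hR.1 h1)) hne
    · exact absurd ((hR.2 Q hQ.1 h1).antisymm h1) hne
  · ext x
    simp only [mem_ofPred_eq, mem_iUnion, exists_prop]
    constructor
    · intro hx
      have hne : (L.filter fun Q => x ∈ Q).Nonempty := by
        by_contra hemp
        rw [Finset.not_nonempty_iff_eq_empty, Finset.filter_eq_empty_iff] at hemp
        have : stepSum L c x = 0 := Finset.sum_eq_zero fun Q hQ =>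
          indicator_of_notMem (hemp hQ) _
        rw [this] at hx
        exact not_lt_zero hx
      obtain ⟨Q, hQ⟩ := Finset.exists_minimal hne
      have hQm := Finset.mem_filter.1 hQ.1
      have hsQ : stepSum L c x ≤ s Q := by
        simp only [stepSum, s, Finset.sum_filter]
        refine Finset.sum_le_sum fun R hR => ?_
        by_cases hxR : x ∈ R
        · have hQR : Q ⊆ R := by
            rcases hL.comparable (R := {x}) (singleton_nonempty x) hQm.1 hR (by simpa using hQm.2)
              (by simpa using hxR) with h1 | h1
            · exact h1
            · exact hQ.2 (Finset.mem_filter.2 ⟨hR, hxR⟩) h1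
          simp [hxR, hQR]
        · simp [hxR]
      have hQK : Q ∈ K := Finset.mem_filter.2 ⟨hQm.1, hx.trans_le hsQ⟩
      obtain ⟨R, hR⟩ := (K.filter fun R => Q ⊆ R).exists_maximal
        ⟨Q, Finset.mem_filter.2 ⟨hQK, subset_rfl⟩⟩
      have hRm := Finset.mem_filter.1 hR.1
      refine ⟨R, Finset.mem_filter.2 ⟨hRm.1, fun R' hR' hRR' => ?_⟩, hRm.2 hQm.2⟩
      exact hR.2 (Finset.mem_filter.2 ⟨hR', hRm.2.trans hRR'⟩) hRR'
    · rintro ⟨Q, hQJ, hxQ⟩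
      exact (Finset.mem_filter.1 (hJK hQJ)).2.trans_le (hle Q x hxQ)
  · intro Q hQ x hx
    rw [Finset.mem_filter] at hQ
    have hsplit : stepSum L c x =
        ∑ R ∈ L with ¬ R ⊆ Q, R.indicator (fun _ => c R) x + stepSum (below L Q) c x := by
      rw [stepSum, stepSum, ← Finset.sum_filter_add_sum_filter_not L (· ⊆ Q), add_comm]
      congr!
    rw [hsplit]
    gcongr
    -- the smallest set strictly above `Q` is not in `K`
    by_cases hne : (L.filter fun R => Q ⊂ R).Nonempty
    · obtain ⟨P, hP⟩ := Finset.exists_minimal hne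
      have hPm := Finset.mem_filter.1 hP.1
      have hsP : s P ≤ t := by
        by_contra hlt
        exact hPm.2.2 (hQ.2 P (Finset.mem_filter.2 ⟨hPm.1, not_le.1 hlt⟩) hPm.2.1)
      refine le_trans ?_ hsP
      simp only [s, Finset.sum_filter]
      refine Finset.sum_le_sum fun R hR => ?_
      by_cases hxR : x ∈ R
      · by_cases hRQ : R ⊆ Q
        · simp [hRQ]
        · have hQR : Q ⊂ R := by
            rcases hL.comparable (R := {x}) (singleton_nonempty x) hR (hKL hQ.1)
              (by simpa using hxR) (by simpa using hx) with h1 | h1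
            · exact absurd h1 hRQ
            · exact ⟨h1, hRQ⟩
          have hPR : P ⊆ R := by
            rcases hL.comparable (R := {x}) (singleton_nonempty x) hPm.1 hR
              (by simpa using hPm.2.1 hx) (by simpa using hxR) with h1 | h1
            · exact h1
            · exact hP.2 (Finset.mem_filter.2 ⟨hR, hQR⟩) h1
          simp [hxR, hRQ, hPR]
      · simp [hxR]
    · refine le_of_eq_of_le (Finset.sum_eq_zero fun R hR => ?_) zero_le
      rw [Finset.mem_filter] at hR
      refine indicator_of_notMem (fun hxR => hne ⟨R, Finset.mem_filter.2 ⟨hR.1, ?_, hR.2⟩⟩) _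
      rcases hL.comparable (R := {x}) (singleton_nonempty x) hR.1 (hKL hQ.1)
        (by simpa using hxR) (by simpa using hx) with h1 | h1
      · exact absurd h1 hR.2
      · exact h1

variable [MeasurableSpace X]

/-- The local estimate at height `t`, by duality and the testing condition. -/
lemma IsCarleson.mul_measure_superlevel_le {p q : ℝ} (hpq : p.HolderConjugate q)
    {μ ν ω : Measure X} {L : Finset (Set X)} {Λ η : ℝ≥0∞} (hL : IsCarleson μ L Λ)
    {g : X → ℝ≥0∞} (hg : Measurable g)
    (htest' : ∀ Q ∈ L, ∀ J ⊆ below L Q, ∫⁻ x, stepSum J (avg μ ω) x ^ q ∂ν ≤ η * ω Q)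
    {t : ℝ≥0∞} (ht : t ≠ ∞) :
    t * ω {x | 2 * t < stepSum L (coef μ ν g) x} ≤ η ^ (1 / q) *
      (∫⁻ x, g x ^ p ∂ν) ^ (1 / p) * ω {x | t < stepSum L (coef μ ν g) x} ^ (1 / q) := by
  classical
  have hp' := hpq.one_div_nonneg
  have hq' := hpq.symm.one_div_nonneg
  obtain ⟨J, hJL, hJd, hJeq, hJle⟩ :=
    hL.toIsLaminar.exists_maximal_superlevel (coef μ ν g) t
  set u := stepSum L (coef μ ν g)
  have hJm : ∀ Q ∈ J, MeasurableSet Q := fun Q hQ => hL.measurable Q (hJL hQ)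
  have hlocal : ∀ Q ∈ J, t * ω ({x | 2 * t < u x} ∩ Q) ≤
      (∫⁻ x in Q, g x ^ p ∂ν) ^ (1 / p) * (η * ω Q) ^ (1 / q) := by
    intro Q hQ
    have hbm : ∀ R ∈ below L Q, MeasurableSet R := fun R hR =>
      hL.measurable R (below_subset L Q hR)
    have hbsub : ∀ R ∈ below L Q, R ⊆ Q := fun R hR => (mem_below.1 hR).2
    have hsub : {x | 2 * t < u x} ∩ Q ⊆ {x | t ≤ stepSum (below L Q) (coef μ ν g) x} := by
      rintro x ⟨hx, hxQ⟩
      have h1 := hJle Q hQ x hxQ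
      rw [mem_ofPred_eq, two_mul] at hx
      exact ((ENNReal.add_lt_add_iff_left ht).1 (hx.trans_le h1)).le
    calc t * ω ({x | 2 * t < u x} ∩ Q)
        ≤ t * ω {x | t ≤ stepSum (below L Q) (coef μ ν g) x} := by gcongr
      _ ≤ ∫⁻ x, stepSum (below L Q) (coef μ ν g) x ∂ω :=
          mul_meas_ge_le_lintegral (measurable_stepSum hbm _) t
      _ = ∑ R ∈ below L Q, coef μ ν g R * ω R := lintegral_stepSum hbm _ _
      _ = ∑ R ∈ below L Q, avg μ ω R * ∫⁻ x in R, g x ∂ν.restrict Q := by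
          refine Finset.sum_congr rfl fun R hR => ?_
          rw [Measure.restrict_restrict (hbm R hR),
            inter_eq_self_of_subset_left (hbsub R hR), coef, avg, div_eq_mul_inv]
          ring
      _ = ∫⁻ x in Q, stepSum (below L Q) (avg μ ω) x * g x ∂ν :=
          (lintegral_stepSum_mul hbm _ _ hg).symm
      _ = ∫⁻ x in Q, g x * stepSum (below L Q) (avg μ ω) x ∂ν := by simp only [mul_comm]
      _ ≤ (∫⁻ x in Q, g x ^ p ∂ν) ^ (1 / p) *
            (∫⁻ x in Q, stepSum (below L Q) (avg μ ω) x ^ q ∂ν) ^ (1 / q) :=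
          ENNReal.lintegral_mul_le_Lp_mul_Lq _ hpq hg.aemeasurable
            (measurable_stepSum hbm _).aemeasurable
      _ ≤ _ := by
          gcongr
          exact (setLIntegral_le_lintegral _ _).trans (htest' Q (hJL hQ) _ subset_rfl)
  have hcover : {x | 2 * t < u x} ⊆ ⋃ Q ∈ J, ({x | 2 * t < u x} ∩ Q) := by
    intro x hx
    have h1 : x ∈ {x | t < u x} := by
      rw [mem_ofPred_eq] at hx ⊢
      exact (le_mul_of_one_le_left' one_le_two).trans_lt hx
    rw [hJeq] at h1
    obtain ⟨Q, hQ, hxQ⟩ := mem_iUnion₂.1 h1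
    exact mem_biUnion hQ ⟨hx, hxQ⟩
  have hpow : ∀ {r : ℝ}, 0 < r → ∀ y : ℝ≥0∞, (y ^ (1 / r)) ^ r = y := fun hr y => by
    rw [← ENNReal.rpow_mul, one_div_mul_cancel hr.ne', ENNReal.rpow_one]
  calc t * ω {x | 2 * t < u x}
      ≤ t * ∑ Q ∈ J, ω ({x | 2 * t < u x} ∩ Q) := by
        gcongr
        exact (measure_mono hcover).trans (measure_biUnion_finset_le _ _)
    _ ≤ ∑ Q ∈ J, (∫⁻ x in Q, g x ^ p ∂ν) ^ (1 / p) * (η * ω Q) ^ (1 / q) := by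
        rw [Finset.mul_sum]
        exact Finset.sum_le_sum hlocal
    _ ≤ (∑ Q ∈ J, ∫⁻ x in Q, g x ^ p ∂ν) ^ (1 / p) * (∑ Q ∈ J, η * ω Q) ^ (1 / q) := by
        refine (ENNReal.inner_le_Lp_mul_Lq J _ _ hpq).trans (le_of_eq ?_)
        simp only [hpow hpq.pos, hpow hpq.symm.pos]
    _ ≤ (∫⁻ x, g x ^ p ∂ν) ^ (1 / p) * (η * ω {x | t < u x}) ^ (1 / q) := by
        gcongr
        · exact (lintegral_biUnion_finset hJd hJm _).symm.le.trans (setLIntegral_le_lintegral _ _)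
        · rw [← Finset.mul_sum, hJeq]
          exact (congrArg (η * ·) (measure_biUnion_finset hJd hJm).symm).le
    _ = _ := by
        rw [ENNReal.mul_rpow_of_nonneg _ _ hq']
        ring

/-- The estimates at the heights `t` and `2 t` are combined by absorption into
`N = sup_t t^p ω{u > t}`, which is finite because `u` is bounded with support of finite measure. -/
lemma IsCarleson.weak_stepSum_le {p q : ℝ} (hpq : p.HolderConjugate q)
    {μ ν ω : Measure X} {L : Finset (Set X)} {Λ η : ℝ≥0∞} (hL : IsCarleson μ L Λ)
    (hω : ∀ Q ∈ L, ω Q ≠ ∞) {g : X → ℝ≥0∞} (hg : Measurable g)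
    (hgfin : ∀ Q ∈ L, ∫⁻ x in Q, g x ∂ν ≠ ∞)
    (htest' : ∀ Q ∈ L, ∀ J ⊆ below L Q, ∫⁻ x, stepSum J (avg μ ω) x ^ q ∂ν ≤ η * ω Q)
    {t : ℝ≥0∞} (ht : t ≠ ∞) :
    t * ω {x | t < stepSum L (coef μ ν g) x} ^ (1 / p) ≤
      2 ^ p * (η ^ (1 / q) * (∫⁻ x, g x ^ p ∂ν) ^ (1 / p)) := by
  have hp0 := hpq.pos
  have hp1 : 0 < p - 1 := by linarith [hpq.lt]
  have hp' := hpq.one_div_nonneg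
  have hq' := hpq.symm.one_div_nonneg
  set u := stepSum L (coef μ ν g)
  set c := η ^ (1 / q) * (∫⁻ x, g x ^ p ∂ν) ^ (1 / p)
  set M := ∑ R ∈ L, coef μ ν g R
  have hM : M ≠ ∞ := ENNReal.sum_ne_top.2 fun R hR => hL.coef_ne_top hR (hgfin R hR)
  set N : ℝ≥0∞ := ⨆ s : ℝ≥0, (s : ℝ≥0∞) ^ p * ω {x | s < u x} with hN_def
  have hN : N ≠ ∞ := by
    refine ne_top_of_le_ne_top (b := M ^ p * ∑ Q ∈ L, ω Q) (ENNReal.mul_ne_top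
      (ENNReal.rpow_ne_top_of_nonneg hp0.le hM) (ENNReal.sum_ne_top.2 hω)) (iSup_le fun s => ?_)
    have hsub : {x | (s : ℝ≥0∞) < u x} ⊆ ⋃ Q ∈ L, Q := by
      intro x hx
      by_contra hxn
      simp only [mem_iUnion, exists_prop, not_exists, not_and] at hxn
      have : u x = 0 := Finset.sum_eq_zero fun Q hQ => indicator_of_notMem (hxn Q hQ) _
      rw [mem_ofPred_eq, this] at hx
      exact not_lt_zero hx
    rcases le_or_gt (s : ℝ≥0∞) M with hs | hs
    · gcongr
      exact (measure_mono hsub).trans (measure_biUnion_finset_le L id)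
    · have : {x | (s : ℝ≥0∞) < u x} = ∅ := by
        refine eq_empty_of_forall_notMem fun x hx => not_lt.2 ?_ (hs.trans hx)
        exact Finset.sum_le_sum fun R _ => indicator_le_self' (fun _ _ => zero_le) x
      simp [this]
  have hstep : N ≤ 2 ^ p * c * N ^ (1 / q) := by
    refine iSup_le fun s => ?_
    set s' : ℝ≥0 := s / 2
    have hs' : (s : ℝ≥0∞) = 2 * (s' : ℝ≥0∞) := by
      rw [← ENNReal.coe_ofNat, ← ENNReal.coe_mul, ENNReal.coe_inj, mul_div_cancel₀]
      norm_num
    have h1 := hL.mul_measure_superlevel_le (ν := ν) hpq hg htest' (t := s') (by simp)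
    have h2 : ((s' : ℝ≥0∞) ^ p) ^ (1 / q) = (s' : ℝ≥0∞) ^ (p - 1) := by
      rw [← ENNReal.rpow_mul]
      congr 1
      rw [mul_one_div, div_eq_iff hpq.symm.pos.ne', hpq.sub_one_mul_conj]
    rw [hs', ENNReal.mul_rpow_of_nonneg _ _ hp0.le]
    calc 2 ^ p * (s' : ℝ≥0∞) ^ p * ω {x | 2 * (s' : ℝ≥0∞) < u x}
        = 2 ^ p * (s' : ℝ≥0∞) ^ (p - 1) * (s' * ω {x | 2 * (s' : ℝ≥0∞) < u x}) := by
          conv_lhs => rw [show p = (p - 1) + 1 by ring]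
          rw [ENNReal.rpow_add_of_nonneg (x := (s' : ℝ≥0∞)) _ _ hp1.le zero_le_one,
            ENNReal.rpow_one, sub_add_cancel]
          ring
      _ ≤ 2 ^ p * (s' : ℝ≥0∞) ^ (p - 1) * (c * ω {x | s' < u x} ^ (1 / q)) := by gcongr
      _ = 2 ^ p * c * ((s' : ℝ≥0∞) ^ p * ω {x | s' < u x}) ^ (1 / q) := by
          rw [ENNReal.mul_rpow_of_nonneg _ _ hq', h2]
          ring
      _ ≤ 2 ^ p * c * N ^ (1 / q) := by
          gcongr
          exact le_iSup (fun s : ℝ≥0 => (s : ℝ≥0∞) ^ p * ω {x | s < u x}) s'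
  have hN' : N ^ (1 / p) ≤ 2 ^ p * c := by
    rcases eq_or_ne N 0 with h0 | h0
    · rw [h0, ENNReal.zero_rpow_of_pos (by positivity)]
      exact zero_le
    have h1 : N = N ^ (1 / p) * N ^ (1 / q) := by
      rw [← ENNReal.rpow_add_of_nonneg _ _ hp' hq', one_div, one_div, hpq.inv_add_inv_eq_one,
        ENNReal.rpow_one]
    exact (ENNReal.mul_le_mul_iff_left (by simp [ENNReal.rpow_eq_zero_iff, h0, hN])
      (by simp [ENNReal.rpow_eq_top_iff, h0, hN])).1 (h1.symm.le.trans hstep)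
  lift t to ℝ≥0 using ht
  calc (t : ℝ≥0∞) * ω {x | t < u x} ^ (1 / p)
      = ((t : ℝ≥0∞) ^ p * ω {x | t < u x}) ^ (1 / p) := by
        rw [ENNReal.mul_rpow_of_nonneg _ _ hp', ← ENNReal.rpow_mul,
          mul_one_div_cancel hp0.ne', ENNReal.rpow_one]
    _ ≤ N ^ (1 / p) := by
        gcongr
        exact le_iSup (fun s : ℝ≥0 => (s : ℝ≥0∞) ^ p * ω {x | s < u x}) t
    _ ≤ _ := hN'

end Weak

/-! ### Cubes, weights and the maximal function -/

section Cubes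

variable {d : ℕ}

lemma IsCube.measurableSet {Q : Set (Fin d → ℝ)} (h : IsCube Q) : MeasurableSet Q := by
  obtain ⟨a, ℓ, -, rfl⟩ := h
  exact MeasurableSet.univ_pi fun _ => measurableSet_Ico

lemma volume_pi_Ico_add (a : Fin d → ℝ) (ℓ : ℝ) :
    volume (Set.univ.pi fun i => Set.Ico (a i) (a i + ℓ)) = ENNReal.ofReal ℓ ^ d := by
  rw [Real.volume_pi_Ico]
  simp

lemma IsCube.volume_ne_zero {Q : Set (Fin d → ℝ)} (h : IsCube Q) : volume Q ≠ 0 := by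
  obtain ⟨a, ℓ, hℓ, rfl⟩ := h
  rw [volume_pi_Ico_add]
  exact pow_ne_zero _ (by simpa using hℓ)

lemma IsCube.volume_ne_top {Q : Set (Fin d → ℝ)} (h : IsCube Q) : volume Q ≠ ∞ := by
  obtain ⟨a, ℓ, hℓ, rfl⟩ := h
  rw [volume_pi_Ico_add]
  exact ENNReal.pow_ne_top ENNReal.ofReal_ne_top

lemma IsCube.nonempty {Q : Set (Fin d → ℝ)} (h : IsCube Q) : Q.Nonempty :=
  nonempty_of_measure_ne_zero h.volume_ne_zero

lemma IsCube.interior_nonempty {Q : Set (Fin d → ℝ)} (h : IsCube Q) : (interior Q).Nonempty := by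
  obtain ⟨a, ℓ, hℓ, rfl⟩ := h
  rw [interior_pi_set finite_univ]
  refine ⟨fun i => a i + ℓ / 2, fun i _ => ?_⟩
  change a i + ℓ / 2 ∈ interior (Set.Ico (a i) (a i + ℓ))
  rw [interior_Ico]
  constructor <;> linarith

lemma IsCube.exists_isCompact {Q : Set (Fin d → ℝ)} (h : IsCube Q) : ∃ K, IsCompact K ∧ Q ⊆ K := by
  obtain ⟨a, ℓ, hℓ, rfl⟩ := h
  exact ⟨_, isCompact_univ_pi fun i => isCompact_Icc (a := a i) (b := a i + ℓ),
    pi_mono fun i _ => Ico_subset_Icc_self⟩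

lemma IsWeight.integrableOn {w : (Fin d → ℝ) → ℝ} (hw : IsWeight w) {Q : Set (Fin d → ℝ)}
    (hQ : IsCube Q) : IntegrableOn w Q := by
  obtain ⟨K, hK, hQK⟩ := hQ.exists_isCompact
  exact (hw.locallyIntegrable.integrableOn_isCompact hK).mono_set hQK

lemma IsWeight.aemeasurable_ofReal {w : (Fin d → ℝ) → ℝ} (hw : IsWeight w) :
    AEMeasurable (fun x => ENNReal.ofReal (w x)) volume :=
  hw.locallyIntegrable.aestronglyMeasurable.aemeasurable.ennreal_ofReal

lemma weightMeasure_apply (w : (Fin d → ℝ) → ℝ) {Q : Set (Fin d → ℝ)} (hQ : IsCube Q) :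
    weightMeasure w Q = ∫⁻ x in Q, ENNReal.ofReal (w x) :=
  withDensity_apply _ hQ.measurableSet

lemma IsWeight.measure_ne_top {w : (Fin d → ℝ) → ℝ} (hw : IsWeight w) {Q : Set (Fin d → ℝ)}
    (hQ : IsCube Q) : weightMeasure w Q ≠ ∞ := by
  rw [weightMeasure_apply w hQ]
  exact (hw.integrableOn hQ).lintegral_lt_top.ne

/-- The average over a cube `R ⊆ Q` is controlled by the centered maximal function at each point
of `R`, as `R` lies in the cube centered at that point of twice its side length. -/
lemma IsWeight.avg_le_maximalFunction {w : (Fin d → ℝ) → ℝ} (hw : IsWeight w)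
    {Q R : Set (Fin d → ℝ)} (hR : IsCube R) (hRQ : R ⊆ Q) {x : Fin d → ℝ} (hx : x ∈ R) :
    avg volume (weightMeasure w) R ≤ 2 ^ d * maximalFunction (Q.indicator w) x := by
  have hR' := hR
  obtain ⟨a, ℓ, hℓ, hRdef⟩ := hR'
  set A : Set (Fin d → ℝ) := Set.univ.pi fun _ => Set.Icc (-ℓ) ℓ
  have hA : MeasurableSet A := MeasurableSet.univ_pi fun _ => measurableSet_Icc
  have h1 : weightMeasure w R ≤ ∫⁻ y in A, ‖Q.indicator w (x + y)‖ₑ := by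
    rw [weightMeasure_apply w hR, ← lintegral_indicator hR.measurableSet,
      ← lintegral_add_left_eq_self _ x, ← lintegral_indicator hA]
    refine lintegral_mono fun y => ?_
    by_cases hy : x + y ∈ R
    · have hyA : y ∈ A := by
        intro i _
        rw [hRdef] at hx hy
        have h1 := hx i (mem_univ i)
        have h2 := hy i (mem_univ i)
        simp only [Pi.add_apply, mem_Ico] at h1 h2
        constructor <;> linarith
      rw [indicator_of_mem hy, indicator_of_mem hyA, indicator_of_mem (hRQ hy),
        Real.enorm_of_nonneg (hw.nonneg _)]
    · rw [indicator_of_notMem hy]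
      exact zero_le
  have h2 : (volume R)⁻¹ = 2 ^ d * (ENNReal.ofReal ((2 * ℓ) ^ d))⁻¹ := by
    have h20 : (2 : ℝ≥0∞) ^ d ≠ 0 := by positivity
    have h2t : (2 : ℝ≥0∞) ^ d ≠ ∞ := ENNReal.pow_ne_top (by norm_num)
    rw [hRdef, volume_pi_Ico_add, mul_pow, ENNReal.ofReal_mul (by positivity),
      ENNReal.ofReal_pow hℓ.le, ENNReal.ofReal_pow (by norm_num), ENNReal.ofReal_ofNat,
      ENNReal.mul_inv (Or.inl h20) (Or.inl h2t), ← mul_assoc, ENNReal.mul_inv_cancel h20 h2t,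
      one_mul]
  rw [avg, div_eq_mul_inv, h2]
  calc weightMeasure w R * (2 ^ d * (ENNReal.ofReal ((2 * ℓ) ^ d))⁻¹)
      ≤ (∫⁻ y in A, ‖Q.indicator w (x + y)‖ₑ) * (2 ^ d * (ENNReal.ofReal ((2 * ℓ) ^ d))⁻¹) := by
        gcongr
    _ = 2 ^ d * ((ENNReal.ofReal ((2 * ℓ) ^ d))⁻¹ * ∫⁻ y in A, ‖Q.indicator w (x + y)‖ₑ) := by
        ring
    _ ≤ _ := by
        gcongr
        exact le_iSup₂_of_le ℓ hℓ le_rfl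

/-- The sum of the `w`-measures of a Carleson family of cubes below `Q`. -/
lemma IsWeight.sum_below_le {w : (Fin d → ℝ) → ℝ} (hw : IsWeight w)
    {L : Finset (Set (Fin d → ℝ))} {Λ : ℝ≥0∞} (hL : IsCarleson volume L Λ)
    (hcube : ∀ Q ∈ L, IsCube Q) {Q : Set (Fin d → ℝ)} (hQ : Q ∈ L) :
    ∑ R ∈ below L Q, weightMeasure w R ≤ 4 * Λ * 2 ^ d * aInfty w * weightMeasure w Q := by
  have hcQ := hcube Q hQ
  rcases eq_or_ne (weightMeasure w Q) 0 with h0 | h0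
  · refine le_of_eq_of_le (Finset.sum_eq_zero fun R hR => ?_) zero_le
    exact measure_mono_null (mem_below.1 hR).2 h0
  have h2t : (2 : ℝ≥0∞) ^ d ≠ ∞ := ENNReal.pow_ne_top (by norm_num)
  calc ∑ R ∈ below L Q, weightMeasure w R
      ≤ 4 * Λ * ∫⁻ x in Q, 2 ^ d * maximalFunction (Q.indicator w) x :=
        (hL.mono (below_subset L Q)).sum_measure_le_lintegral
          (fun R hR => hw.measure_ne_top (hcube R (below_subset L Q hR)))
          (fun R hR => (mem_below.1 hR).2) _ fun R hR x hx =>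
            hw.avg_le_maximalFunction (hcube R (below_subset L Q hR)) (mem_below.1 hR).2 hx
    _ = 4 * Λ * 2 ^ d * ((weightMeasure w Q)⁻¹ * ∫⁻ x in Q, maximalFunction (Q.indicator w) x) *
          weightMeasure w Q := by
        rw [lintegral_const_mul' _ _ h2t]
        have h1 := ENNReal.inv_mul_cancel h0 (hw.measure_ne_top hcQ)
        calc _ = 4 * Λ * 2 ^ d * (∫⁻ x in Q, maximalFunction (Q.indicator w) x) * 1 := by ring
          _ = _ := by rw [← h1]; ring
    _ ≤ _ := by
        gcongr
        exact le_iSup₂_of_le (f := fun (Q : Set (Fin d → ℝ)) (_ : IsCube Q) =>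
          (weightMeasure w Q)⁻¹ * ∫⁻ x in Q, maximalFunction (Q.indicator w) x) Q hcQ le_rfl

lemma twoWeightAp_symm {p q : ℝ} (w σ : (Fin d → ℝ) → ℝ) :
    twoWeightAp q p σ w = twoWeightAp p q w σ := by
  simp only [twoWeightAp, mul_comm]

lemma avg_mul_avg_rpow_le {p q : ℝ} (hpq : p.HolderConjugate q) (w σ : (Fin d → ℝ) → ℝ)
    {Q : Set (Fin d → ℝ)} (hQ : IsCube Q) :
    avg volume (weightMeasure w) Q * avg volume (weightMeasure σ) Q ^ (p - 1) ≤
      twoWeightAp p q w σ ^ p := by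
  have h1 : avg volume (weightMeasure w) Q ^ (1 / p) * avg volume (weightMeasure σ) Q ^ (1 / q) ≤
      twoWeightAp p q w σ :=
    le_iSup₂_of_le (f := fun (Q : Set (Fin d → ℝ)) (_ : IsCube Q) =>
      (weightMeasure w Q / volume Q) ^ (1 / p) * (weightMeasure σ Q / volume Q) ^ (1 / q))
      Q hQ le_rfl
  have h2 := ENNReal.rpow_le_rpow h1 hpq.nonneg
  rw [ENNReal.mul_rpow_of_nonneg _ _ hpq.nonneg, ← ENNReal.rpow_mul, ← ENNReal.rpow_mul,
    one_div_mul_cancel hpq.ne_zero, ENNReal.rpow_one] at h2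
  have h3 : 1 / q * p = p - 1 := by
    rw [one_div_mul_eq_div, div_eq_iff hpq.symm.ne_zero, hpq.sub_one_mul_conj]
  rwa [h3] at h2

end Cubes

/-! ### Dyadic grids and families of type `L` -/

section Grid

variable {d : ℕ}

/-- A cube strictly inside another one leaves room for a second cube of its own size. -/
lemma IsDyadicGrid.two_mul_volume_le {D : Set (Set (Fin d → ℝ))} (hD : IsDyadicGrid D)
    {R Q : Set (Fin d → ℝ)} (hR : R ∈ D) (hQ : Q ∈ D) (hRQ : R ⊂ Q) :
    2 * volume R ≤ volume Q := by
  obtain ⟨x, hxQ, hxR⟩ := exists_of_ssubset hRQ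
  obtain ⟨R', ⟨hR', hvol, hxR'⟩, -⟩ := hD.partition R hR x
  obtain ⟨y, hy⟩ := (hD.isCube R hR).nonempty
  have hdisj : Disjoint R R' := by
    rw [Set.disjoint_left]
    intro z hz hz'
    have := (hD.partition R hR z).unique ⟨hR, rfl, hz⟩ ⟨hR', hvol, hz'⟩
    exact hxR (this ▸ hxR')
  have hsub : R' ⊆ Q := by
    rcases hD.nested R' hR' Q hQ with h1 | h1 | h1
    · exact absurd (h1 ▸ ⟨hxR', hxQ⟩ : x ∈ (∅ : Set (Fin d → ℝ))) (notMem_empty x)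
    · exact inter_eq_left.1 h1
    · exact absurd (inter_eq_right.1 h1 (hRQ.1 hy)) (Set.disjoint_left.1 hdisj hy)
  calc 2 * volume R = volume R + volume R' := by rw [hvol, two_mul]
    _ = volume (R ∪ R') := (measure_union hdisj (hD.isCube R' hR').measurableSet).symm
    _ ≤ volume Q := measure_mono (union_subset hRQ.1 hsub)

/-- A dyadic grid is countable: the cubes of a given volume are disjoint, and distinct volumes
differ by a factor of at least `2`. -/
lemma IsDyadicGrid.countable {D : Set (Set (Fin d → ℝ))} (hD : IsDyadicGrid D) : D.Countable := by
  have hvol : (volume '' D).Countable := by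
    refine Set.PairwiseDisjoint.countable_of_Ioo (y := fun v => 2 * v) ?_ ?_
    · have key : ∀ R ∈ D, ∀ Q ∈ D, volume R < volume Q → 2 * volume R ≤ volume Q := by
        intro R hR Q hQ hlt
        obtain ⟨y, hy⟩ := (hD.isCube R hR).nonempty
        obtain ⟨Q', ⟨hQ', hvol, hyQ'⟩, -⟩ := hD.partition Q hQ y
        rw [← hvol] at hlt ⊢
        refine hD.two_mul_volume_le hR hQ' ?_
        rcases hD.nested R hR Q' hQ' with h1 | h1 | h1
        · exact absurd (h1 ▸ ⟨hy, hyQ'⟩ : y ∈ (∅ : Set (Fin d → ℝ))) (notMem_empty y)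
        · exact (inter_eq_left.1 h1).ssubset_of_ne fun h => hlt.ne (by rw [h])
        · exact absurd (measure_mono (inter_eq_right.1 h1)) (not_le.2 hlt)
      rintro _ ⟨R, hR, rfl⟩ _ ⟨Q, hQ, rfl⟩ hne
      rw [Function.onFun, Set.disjoint_left]
      rintro z ⟨h1, h2⟩ ⟨h3, h4⟩
      rcases hne.lt_or_gt with hlt | hlt
      · exact absurd ((h2.trans_le (key R hR Q hQ hlt)).trans h3) (lt_irrefl z)
      · exact absurd ((h4.trans_le (key Q hQ R hR hlt)).trans h1) (lt_irrefl z)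
    · rintro _ ⟨Q, hQ, rfl⟩
      rw [two_mul]
      exact ENNReal.lt_add_right (hD.isCube Q hQ).volume_ne_top (hD.isCube Q hQ).volume_ne_zero
  have hcover : D ⊆ ⋃ v ∈ volume '' D, {Q | Q ∈ D ∧ volume Q = v} := fun Q hQ =>
    mem_biUnion (mem_image_of_mem _ hQ) ⟨hQ, rfl⟩
  refine (hvol.biUnion fun v _ => ?_).mono hcover
  refine Set.PairwiseDisjoint.countable_of_nonempty_interior (s := id) ?_
    fun Q hQ => (hD.isCube Q hQ.1).interior_nonempty
  rintro R ⟨hR, hRv⟩ Q ⟨hQ, hQv⟩ hne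
  refine Set.disjoint_left.2 fun z hz hz' => hne ?_
  exact (hD.partition R hR z).unique ⟨hR, rfl, hz⟩ ⟨hQ, hQv.trans hRv.symm, hz'⟩

lemma ENNReal.le_exp_coe (y : ℝ≥0∞) : y ≤ EReal.exp (y : EReal) := by
  rcases eq_or_ne y ∞ with rfl | hy
  · simp
  lift y to ℝ≥0 using hy
  have h1 : (((y : ℝ≥0∞)) : EReal) = ((y : ℝ) : EReal) := rfl
  rw [h1, EReal.exp_coe, ← ENNReal.ofReal_coe_nnreal]
  exact ENNReal.ofReal_le_ofReal ((lt_add_one _).le.trans (Real.add_one_le_exp _))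

/-- Exponential integrability implies the packing condition. -/
lemma IsTypeL.sum_volume_le {L : Set (Set (Fin d → ℝ))} {Λ : ℝ} (hL : IsTypeL L Λ)
    (hcube : ∀ Q ∈ L, IsCube Q) {Q : Set (Fin d → ℝ)} (hQ : Q ∈ L)
    {K : Finset (Set (Fin d → ℝ))} (hK : ∀ R ∈ K, R ∈ L ∧ R ⊆ Q) :
    ∑ R ∈ K, volume R ≤ 2 * ENNReal.ofReal Λ * volume Q := by
  classical
  have hΛ0 : ENNReal.ofReal Λ ≠ 0 := by simpa using hL.1
  have hΛt : ENNReal.ofReal Λ ≠ ∞ := ENNReal.ofReal_ne_top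
  set N : (Fin d → ℝ) → ℝ≥0∞ := fun x =>
    ∑' R : {R : Set (Fin d → ℝ) // R ∈ L ∧ R ⊆ Q}, R.1.indicator (fun _ => (1 : ℝ≥0∞)) x
  have h1 : ∫⁻ x in Q, EReal.exp (((ENNReal.ofReal Λ)⁻¹ * N x : ℝ≥0∞) : EReal) ≤
      2 * volume Q := by
    have := hL.2 Q hQ
    rwa [setLAverage_eq, ENNReal.div_le_iff (hcube Q hQ).volume_ne_zero
      (hcube Q hQ).volume_ne_top] at this
  have hKm : ∀ R ∈ K, MeasurableSet R := fun R hR => (hcube R (hK R hR).1).measurableSet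
  calc ∑ R ∈ K, volume R = ∑ R ∈ K, 1 * volume.restrict Q R := by
        refine Finset.sum_congr rfl fun R hR => ?_
        rw [one_mul, Measure.restrict_apply (hKm R hR), inter_eq_self_of_subset_left (hK R hR).2]
    _ = ∫⁻ x in Q, stepSum K (fun _ => 1) x := (lintegral_stepSum hKm _ _).symm
    _ ≤ ∫⁻ x in Q, ENNReal.ofReal Λ *
          EReal.exp (((ENNReal.ofReal Λ)⁻¹ * N x : ℝ≥0∞) : EReal) := by
        refine lintegral_mono fun x => ?_
        calc stepSum K (fun _ => 1) x
            = ∑ R ∈ K.subtype (fun R => R ∈ L ∧ R ⊆ Q),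
                R.1.indicator (fun _ => (1 : ℝ≥0∞)) x :=
              (Finset.sum_subtype_of_mem
                (f := fun R : Set (Fin d → ℝ) => R.indicator (fun _ => (1 : ℝ≥0∞)) x) hK).symm
          _ ≤ N x := ENNReal.sum_le_tsum _
          _ = ENNReal.ofReal Λ * ((ENNReal.ofReal Λ)⁻¹ * N x) := by
              rw [← mul_assoc, ENNReal.mul_inv_cancel hΛ0 hΛt, one_mul]
          _ ≤ _ := by
              gcongr
              exact ENNReal.le_exp_coe _
    _ ≤ ENNReal.ofReal Λ * (2 * volume Q) := by
        rw [lintegral_const_mul' _ _ hΛt]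
        gcongr
    _ = _ := by ring

lemma IsTypeL.isCarleson {D L : Set (Set (Fin d → ℝ))} (hD : IsDyadicGrid D) (hLD : L ⊆ D)
    {Λ : ℝ} (hL : IsTypeL L Λ) {K : Finset (Set (Fin d → ℝ))} (hK : ∀ Q ∈ K, Q ∈ L) :
    IsCarleson volume K (2 * ENNReal.ofReal Λ) where
  nonempty Q hQ := (hD.isCube Q (hLD (hK Q hQ))).nonempty
  nested Q hQ R hR := by
    rcases hD.nested Q (hLD (hK Q hQ)) R (hLD (hK R hR)) with h1 | h1 | h1
    · exact Or.inl (Set.disjoint_iff_inter_eq_empty.2 h1)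
    · exact Or.inr (Or.inl (inter_eq_left.1 h1))
    · exact Or.inr (Or.inr (inter_eq_right.1 h1))
  measurable Q hQ := (hD.isCube Q (hLD (hK Q hQ))).measurableSet
  ne_zero Q hQ := (hD.isCube Q (hLD (hK Q hQ))).volume_ne_zero
  ne_top Q hQ := (hD.isCube Q (hLD (hK Q hQ))).volume_ne_top
  sum_le Q hQ J hJ hJQ := hL.sum_volume_le (fun R hR => hD.isCube R (hLD hR)) (hK Q hQ)
    fun R hR => ⟨hK R (hJ hR), hJQ R hR⟩

end Grid

/-! ### The positive operator of an infinite family -/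

section Operator

variable {d : ℕ}

/-- The positive operator `∑_{Q ∈ L} 1_Q |Q|⁻¹ ∫_Q g dν`. -/
noncomputable def posOp (L : Set (Set (Fin d → ℝ))) (ν : Measure (Fin d → ℝ))
    (g : (Fin d → ℝ) → ℝ≥0∞) (x : Fin d → ℝ) : ℝ≥0∞ :=
  ∑' Q : L, Q.1.indicator (fun _ => coef volume ν g Q.1) x

lemma posOp_eq_iSup (L : Set (Set (Fin d → ℝ))) (ν : Measure (Fin d → ℝ))
    (g : (Fin d → ℝ) → ℝ≥0∞) (x : Fin d → ℝ) :
    posOp L ν g x = ⨆ s : Finset L,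
      stepSum (s.map (Function.Embedding.subtype _)) (coef volume ν g) x := by
  rw [posOp, ENNReal.tsum_eq_iSup_sum]
  simp [stepSum]

lemma stepSum_map_mono (L : Set (Set (Fin d → ℝ))) (c : Set (Fin d → ℝ) → ℝ≥0∞)
    {s t : Finset L} (hst : s ⊆ t) (x : Fin d → ℝ) :
    stepSum (s.map (Function.Embedding.subtype _)) c x ≤
      stepSum (t.map (Function.Embedding.subtype _)) c x :=
  Finset.sum_le_sum_of_subset (Finset.map_subset_map.2 hst)

lemma lintegral_posOp_rpow_le {L : Set (Set (Fin d → ℝ))} (hL : L.Countable)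
    (hm : ∀ Q ∈ L, MeasurableSet Q) {ν ω : Measure (Fin d → ℝ)} {g : (Fin d → ℝ) → ℝ≥0∞}
    {p : ℝ} (hp : 0 < p) {c : ℝ≥0∞}
    (h : ∀ K : Finset (Set (Fin d → ℝ)), (∀ Q ∈ K, Q ∈ L) →
      ∫⁻ x, stepSum K (coef volume ν g) x ^ p ∂ω ≤ c) :
    ∫⁻ x, posOp L ν g x ^ p ∂ω ≤ c := by
  have := hL.to_subtype
  have hmem : ∀ s : Finset L, ∀ Q ∈ s.map (Function.Embedding.subtype _), Q ∈ L := by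
    intro s Q hQ
    obtain ⟨R, -, rfl⟩ := Finset.mem_map.1 hQ
    exact R.2
  have h1 : ∀ x, posOp L ν g x ^ p = ⨆ s : Finset L,
      stepSum (s.map (Function.Embedding.subtype _)) (coef volume ν g) x ^ p := by
    intro x
    rw [posOp_eq_iSup]
    exact (ENNReal.orderIsoRpow p hp).map_iSup _
  simp only [h1]
  rw [lintegral_iSup_directed]
  · exact iSup_le fun s => h _ (hmem s)
  · exact fun s => ((measurable_stepSum (fun Q hQ => hm Q (hmem s Q hQ)) _).pow_const p).aemeasurable
  · refine Monotone.directed_le fun s t hst x => ?_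
    exact ENNReal.rpow_le_rpow (stepSum_map_mono L _ hst x) hp.le

lemma weak_posOp_le {L : Set (Set (Fin d → ℝ))} (hL : L.Countable)
    {ν ω : Measure (Fin d → ℝ)} {g : (Fin d → ℝ) → ℝ≥0∞}
    {p : ℝ} (hp : 0 < p) {c t : ℝ≥0∞}
    (h : ∀ K : Finset (Set (Fin d → ℝ)), (∀ Q ∈ K, Q ∈ L) →
      t * ω {x | t < stepSum K (coef volume ν g) x} ^ (1 / p) ≤ c) :
    t * ω {x | t < posOp L ν g x} ^ (1 / p) ≤ c := by
  have := hL.to_subtype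
  have hmem : ∀ s : Finset L, ∀ Q ∈ s.map (Function.Embedding.subtype _), Q ∈ L := by
    intro s Q hQ
    obtain ⟨R, -, rfl⟩ := Finset.mem_map.1 hQ
    exact R.2
  have hset : {x | t < posOp L ν g x} = ⋃ s : Finset L,
      {x | t < stepSum (s.map (Function.Embedding.subtype _)) (coef volume ν g) x} := by
    ext x
    simp only [mem_ofPred_eq, mem_iUnion, posOp_eq_iSup, lt_iSup_iff]
  have hdir : Directed (· ⊆ ·) fun s : Finset L =>
      {x | t < stepSum (s.map (Function.Embedding.subtype _)) (coef volume ν g) x} :=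
    Monotone.directed_le fun s s' hst x hx => by
      rw [mem_ofPred_eq] at hx ⊢
      exact hx.trans_le (stepSum_map_mono L _ hst x)
  rw [hset, hdir.measure_iUnion]
  have hp' : 0 < 1 / p := by positivity
  have hmap := (ENNReal.orderIsoRpow (1 / p) hp').map_iSup fun s : Finset L =>
    ω {x | t < stepSum (s.map (Function.Embedding.subtype _)) (coef volume ν g) x}
  simp only [ENNReal.orderIsoRpow_apply] at hmap
  rw [hmap, ENNReal.mul_iSup]
  exact iSup_le fun s => h _ (hmem s)

/-- The weak and the strong bound for the positive operator of a family of type `L`. No finiteness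
of the characteristics is assumed. -/
lemma exists_posOp_le (d : ℕ) {p q : ℝ} (hpq : p.HolderConjugate q) : ∃ C : ℝ≥0,
    ∀ D : Set (Set (Fin d → ℝ)), IsDyadicGrid D → ∀ L ⊆ D, ∀ Λ : ℝ, IsTypeL L Λ →
    ∀ w σ : (Fin d → ℝ) → ℝ, IsWeight w → IsWeight σ →
    ∀ g : (Fin d → ℝ) → ℝ≥0∞, Measurable g →
    (∀ Q ∈ L, ∫⁻ x in Q, g x ∂weightMeasure σ ≠ ∞) →
    (∀ t : ℝ≥0, t * weightMeasure w {x | t < posOp L (weightMeasure σ) g x} ^ (1 / p) ≤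
      C * ENNReal.ofReal Λ * twoWeightAp p q w σ * aInfty w ^ (1 / q) *
        (∫⁻ x, g x ^ p ∂weightMeasure σ) ^ (1 / p)) ∧
    (∫⁻ x, posOp L (weightMeasure σ) g x ^ p ∂weightMeasure w) ^ (1 / p) ≤
      C * ENNReal.ofReal Λ * twoWeightAp p q w σ *
        max (aInfty σ ^ (1 / p)) (aInfty w ^ (1 / q)) *
        (∫⁻ x, g x ^ p ∂weightMeasure σ) ^ (1 / p) := by
  have hp0 := hpq.pos
  have hq0 := hpq.symm.pos
  have hp' := hpq.one_div_nonneg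
  have hq' := hpq.symm.one_div_nonneg
  obtain ⟨Cp, hCp⟩ := exists_testing (X := Fin d → ℝ) hpq.lt
  obtain ⟨Cq, hCq⟩ := exists_testing (X := Fin d → ℝ) hpq.symm.lt
  set Γp : ℝ≥0∞ := (Cp * 4 * 2 ^ d) ^ (1 / p) * 2 with hΓp
  set Γq : ℝ≥0∞ := (Cq * 4 * 2 ^ d) ^ (1 / q) * 2 with hΓq
  have hΓt : ∀ (c : ℝ≥0) {r : ℝ}, 0 ≤ r → ((c * 4 * 2 ^ d : ℝ≥0∞)) ^ r * 2 ≠ ∞ := by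
    intro c r hr
    have h2t : (2 : ℝ≥0∞) ^ d ≠ ∞ := ENNReal.pow_ne_top (by norm_num)
    exact ENNReal.mul_ne_top (ENNReal.rpow_ne_top_of_nonneg hr (by finiteness)) (by norm_num)
  have hΓpt : Γp ≠ ∞ := hΓt Cp hp'
  have hΓqt : Γq ≠ ∞ := hΓt Cq hq'
  have htc := testingConst_ne_top hpq.lt hpq.symm.lt
  have h2p : (2 : ℝ≥0∞) ^ p ≠ ∞ := ENNReal.rpow_ne_top_of_nonneg hp0.le (by norm_num)
  obtain ⟨C, hC⟩ : ∃ C : ℝ≥0,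
      (C : ℝ≥0∞) = 2 ^ p * Γq + 2 * testingConst p q * (Γp + Γq) :=
    ⟨_, ENNReal.coe_toNNReal (by finiteness)⟩
  refine ⟨C, fun D hD L hLD Λ hL w σ hw hσ g hg hgfin => ?_⟩
  have hcube : ∀ Q ∈ L, IsCube Q := fun Q hQ => hD.isCube Q (hLD hQ)
  have hcount : L.Countable := hD.countable.mono hLD
  set A := twoWeightAp p q w σ with hA
  set ν := weightMeasure σ with hν
  set ω := weightMeasure w with hω
  set Λe := ENNReal.ofReal Λ
  set G := ∫⁻ x, g x ^ p ∂ν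
  set θ : ℝ≥0∞ := Cp * (2 * Λe) ^ (p - 1) * A ^ p * (4 * (2 * Λe) * 2 ^ d * aInfty σ) with hθ
  set η : ℝ≥0∞ := Cq * (2 * Λe) ^ (q - 1) * A ^ q * (4 * (2 * Λe) * 2 ^ d * aInfty w) with hη
  -- the roots of the testing constants, in which `Λ` and `A` appear to the first power
  have hroot : ∀ (c a : ℝ≥0∞) {r : ℝ}, 1 < r →
      (c * (2 * Λe) ^ (r - 1) * A ^ r * (4 * (2 * Λe) * 2 ^ d * a)) ^ (1 / r) =
        (c * 4 * 2 ^ d) ^ (1 / r) * 2 * Λe * A * a ^ (1 / r) := by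
    intro c a r hr
    have hr0 : 0 < r := by linarith
    have hr' : 0 ≤ 1 / r := by positivity
    have h1 : c * (2 * Λe) ^ (r - 1) * A ^ r * (4 * (2 * Λe) * 2 ^ d * a) =
        c * 4 * 2 ^ d * (2 * Λe * A) ^ r * a := by
      have h2 : (2 * Λe) ^ r = (2 * Λe) ^ (r - 1) * (2 * Λe) := by
        conv_lhs => rw [show r = (r - 1) + 1 by ring]
        rw [ENNReal.rpow_add_of_nonneg _ _ (by linarith) zero_le_one, ENNReal.rpow_one]
      rw [ENNReal.mul_rpow_of_nonneg _ A hr0.le, h2]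
      ring
    rw [h1, ENNReal.mul_rpow_of_nonneg _ a hr', ENNReal.mul_rpow_of_nonneg (c * 4 * 2 ^ d) _ hr',
      ← ENNReal.rpow_mul, mul_one_div_cancel hr0.ne', ENNReal.rpow_one]
    ring
  have hθr : θ ^ (1 / p) = Γp * Λe * A * aInfty σ ^ (1 / p) := hroot Cp (aInfty σ) hpq.lt
  have hηr : η ^ (1 / q) = Γq * Λe * A * aInfty w ^ (1 / q) := hroot Cq (aInfty w) hpq.symm.lt
  have hfinite : ∀ K : Finset (Set (Fin d → ℝ)), (∀ Q ∈ K, Q ∈ L) →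
      IsCarleson volume K (2 * Λe) ∧ (∀ Q ∈ K, ν Q ≠ ∞) ∧ (∀ Q ∈ K, ω Q ≠ ∞) ∧
      (∀ Q ∈ K, ∀ J ⊆ below K Q, ∫⁻ x, stepSum J (avg volume ν) x ^ p ∂ω ≤ θ * ν Q) ∧
      (∀ Q ∈ K, ∀ J ⊆ below K Q, ∫⁻ x, stepSum J (avg volume ω) x ^ q ∂ν ≤ η * ω Q) := by
    intro K hK
    have hCarl := hL.isCarleson hD hLD hK
    have hKc : ∀ Q ∈ K, IsCube Q := fun Q hQ => hcube Q (hK Q hQ)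
    have hνK : ∀ Q ∈ K, ν Q ≠ ∞ := fun Q hQ => hσ.measure_ne_top (hKc Q hQ)
    have hωK : ∀ Q ∈ K, ω Q ≠ ∞ := fun Q hQ => hw.measure_ne_top (hKc Q hQ)
    refine ⟨hCarl, hνK, hωK, ?_, ?_⟩
    · exact hCp volume ν ω K (2 * Λe) (A ^ p) _ hCarl hνK hωK
        (fun Q hQ => avg_mul_avg_rpow_le hpq w σ (hKc Q hQ))
        (fun Q hQ => hσ.sum_below_le hCarl hKc hQ)
    · refine hCq volume ω ν K (2 * Λe) (A ^ q) _ hCarl hωK hνK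
        (fun Q hQ => ?_) (fun Q hQ => hw.sum_below_le hCarl hKc hQ)
      rw [hA, ← twoWeightAp_symm]
      exact avg_mul_avg_rpow_le hpq.symm σ w (hKc Q hQ)
  constructor
  · intro t
    refine weak_posOp_le hcount hp0 fun K hK => ?_
    obtain ⟨hCarl, -, hωK, -, htest'⟩ := hfinite K hK
    refine (hCarl.weak_stepSum_le hpq hωK hg (fun Q hQ => hgfin Q (hK Q hQ)) htest'
      (by simp)).trans ?_
    calc 2 ^ p * (η ^ (1 / q) * G ^ (1 / p))
        = 2 ^ p * Γq * Λe * A * aInfty w ^ (1 / q) * G ^ (1 / p) := by rw [hηr]; ring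
      _ ≤ C * Λe * A * aInfty w ^ (1 / q) * G ^ (1 / p) := by
          gcongr
          rw [hC]
          exact le_self_add
  · have h1 : ∫⁻ x, posOp L ν g x ^ p ∂ω ≤
        (2 * (testingConst p q * (θ ^ (1 / p) + η ^ (1 / q)))) ^ p * G := by
      refine lintegral_posOp_rpow_le hcount (fun Q hQ => (hcube Q hQ).measurableSet) hp0
        fun K hK => ?_
      obtain ⟨hCarl, hνK, hωK, htest, htest'⟩ := hfinite K hK
      exact hCarl.lintegral_stepSum_coef_rpow_le hpq hνK hωK hg
        (fun Q hQ => hgfin Q (hK Q hQ)) htest htest'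
    set m := max (aInfty σ ^ (1 / p)) (aInfty w ^ (1 / q))
    calc (∫⁻ x, posOp L ν g x ^ p ∂ω) ^ (1 / p)
        ≤ ((2 * (testingConst p q * (θ ^ (1 / p) + η ^ (1 / q)))) ^ p * G) ^ (1 / p) := by gcongr
      _ = 2 * (testingConst p q * (θ ^ (1 / p) + η ^ (1 / q))) * G ^ (1 / p) := by
          rw [ENNReal.mul_rpow_of_nonneg _ _ hp', ← ENNReal.rpow_mul,
            mul_one_div_cancel hp0.ne', ENNReal.rpow_one]
      _ ≤ 2 * (testingConst p q * (Γp * Λe * A * m + Γq * Λe * A * m)) * G ^ (1 / p) := by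
          rw [hθr, hηr]
          gcongr
          · exact le_max_left _ _
          · exact le_max_right _ _
      _ = 2 * testingConst p q * (Γp + Γq) * Λe * A * m * G ^ (1 / p) := by ring
      _ ≤ C * Λe * A * m * G ^ (1 / p) := by
          gcongr
          rw [hC]
          exact le_add_self

lemma enorm_cubeTerm_le {σ : (Fin d → ℝ) → ℝ} (hσ : IsWeight σ) {f : (Fin d → ℝ) → ℂ}
    {g : (Fin d → ℝ) → ℝ≥0∞} (hfg : ∀ᵐ x ∂weightMeasure σ, ‖f x‖ₑ = g x)
    {Q : Set (Fin d → ℝ)} (hQ : IsCube Q) (x : Fin d → ℝ) :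
    ‖cubeTerm Q (fun y => (σ y : ℂ) * f y) x‖ₑ ≤
      Q.indicator (fun _ => coef volume (weightMeasure σ) g Q) x := by
  by_cases hx : x ∈ Q
  · rw [cubeTerm, indicator_of_mem hx, indicator_of_mem hx, setAverage_eq, enorm_smul, coef]
    have h1 : ‖(volume.real Q)⁻¹‖ₑ = (volume Q)⁻¹ := by
      have hpos : 0 < volume.real Q := ENNReal.toReal_pos hQ.volume_ne_zero hQ.volume_ne_top
      rw [Real.enorm_of_nonneg (by positivity), ENNReal.ofReal_inv_of_pos hpos, Measure.real,
        ENNReal.ofReal_toReal hQ.volume_ne_top]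
    have h2 : ∫⁻ y in Q, g y ∂weightMeasure σ = ∫⁻ y in Q, ‖(σ y : ℂ) * f y‖ₑ := by
      rw [← lintegral_congr_ae (ae_restrict_of_ae hfg), weightMeasure,
        restrict_withDensity hQ.measurableSet,
        lintegral_withDensity_eq_lintegral_mul_non_measurable₀ _
          hσ.aemeasurable_ofReal.restrict (by simp)]
      refine lintegral_congr fun y => ?_
      rw [Pi.mul_apply, enorm_mul]
      congr 1
      rw [← ofReal_norm, Complex.norm_real, Real.norm_of_nonneg (hσ.nonneg y)]
    rw [h1, h2]
    gcongr
    exact enorm_integral_le_lintegral_enorm _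
  · rw [cubeTerm, indicator_of_notMem hx, indicator_of_notMem hx, enorm_zero]

end Operator

/-! ### The two weight bounds -/

theorem proposition3p4 (d : ℕ) (hd : 1 ≤ d) (p q : ℝ) (hpq : p.HolderConjugate q) :
    ∃ C : ℝ≥0, ∀ D : Set (Set (Fin d → ℝ)), IsDyadicGrid D →
      ∀ L ⊆ D, ∀ Λ : ℝ, IsTypeL L Λ →
      ∀ w σ : (Fin d → ℝ) → ℝ, IsWeight w → IsWeight σ →
      ∀ f : (Fin d → ℝ) → ℂ, MemLp f (ENNReal.ofReal p) (weightMeasure σ) →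
        -- each average is well defined
        (∀ Q ∈ L, IntegrableOn (fun y => (σ y : ℂ) * f y) Q volume) ∧
        -- the series converges absolutely, if the weak-type bound is finite
        (twoWeightAp p q w σ * aInfty w ^ (1 / q) ≠ ∞ →
          ∀ᵐ x ∂(weightMeasure w),
            Summable fun Q : L => ‖cubeTerm Q.1 (fun y => (σ y : ℂ) * f y) x‖) ∧
        -- the weak-type bound
        weakLpNorm (dyadicOp L fun y => (σ y : ℂ) * f y) p (weightMeasure w) ≤
          C * ENNReal.ofReal Λ * twoWeightAp p q w σ * aInfty w ^ (1 / q) *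
            eLpNorm f (ENNReal.ofReal p) (weightMeasure σ) ∧
        -- the strong-type bound
        eLpNorm (dyadicOp L fun y => (σ y : ℂ) * f y) (ENNReal.ofReal p) (weightMeasure w) ≤
          C * ENNReal.ofReal Λ * twoWeightAp p q w σ *
            max (aInfty σ ^ (1 / p)) (aInfty w ^ (1 / q)) *
            eLpNorm f (ENNReal.ofReal p) (weightMeasure σ) := by
  have hp0 := hpq.pos
  have hp1 : 1 < p := hpq.lt
  have hpE : ENNReal.ofReal p ≠ 0 := by simpa using hp0
  have hpR : (ENNReal.ofReal p).toReal = p := ENNReal.toReal_ofReal hp0.le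
  have hp' : 0 < 1 / p := by positivity
  obtain ⟨C, hC⟩ := exists_posOp_le d hpq
  refine ⟨C, fun D hD L hLD Λ hL w σ hw hσ f hf => ?_⟩
  have hcube : ∀ Q ∈ L, IsCube Q := fun Q hQ => hD.isCube Q (hLD hQ)
  -- a measurable representative of `|f|`
  set g : (Fin d → ℝ) → ℝ≥0∞ := fun x => ‖hf.1.mk f x‖ₑ
  have hg : Measurable g := hf.1.stronglyMeasurable_mk.measurable.enorm
  have hfg : ∀ᵐ x ∂weightMeasure σ, ‖f x‖ₑ = g x := by
    filter_upwards [hf.1.ae_eq_mk] with x hx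
    rw [hx]
  have hint : ∀ Q ∈ L, IntegrableOn f Q (weightMeasure σ) := by
    intro Q hQ
    have : IsFiniteMeasure ((weightMeasure σ).restrict Q) :=
      ⟨by simpa using (hσ.measure_ne_top (hcube Q hQ)).lt_top⟩
    exact (hf.restrict Q).integrable (by simpa using hp1.le)
  have hgfin : ∀ Q ∈ L, ∫⁻ x in Q, g x ∂weightMeasure σ ≠ ∞ := by
    intro Q hQ
    rw [← lintegral_congr_ae (ae_restrict_of_ae hfg)]
    exact (hint Q hQ).2.ne
  have hnorm : (∫⁻ x, g x ^ p ∂weightMeasure σ) ^ (1 / p) =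
      eLpNorm f (ENNReal.ofReal p) (weightMeasure σ) := by
    rw [eLpNorm_eq_lintegral_rpow_enorm_toReal hpE ENNReal.ofReal_ne_top, hpR]
    congr 1
    refine lintegral_congr_ae ?_
    filter_upwards [hfg] with x hx
    rw [hx]
  obtain ⟨hweak, hstrong⟩ := hC D hD L hLD Λ hL w σ hw hσ g hg hgfin
  rw [hnorm] at hweak hstrong
  set T := posOp L (weightMeasure σ) g
  have hsum : ∀ x, ∑' Q : L, ‖cubeTerm Q.1 (fun y => (σ y : ℂ) * f y) x‖ₑ ≤ T x := fun x =>
    ENNReal.tsum_le_tsum fun Q => enorm_cubeTerm_le hσ hfg (hcube Q.1 Q.2) x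
  have hop : ∀ x, ‖dyadicOp L (fun y => (σ y : ℂ) * f y) x‖ₑ ≤ T x := fun x =>
    enorm_tsum_le_tsum_enorm.trans (hsum x)
  refine ⟨fun Q hQ => ?_, fun hfin => ?_, ?_, ?_⟩
  · have h1 := hint Q hQ
    rw [IntegrableOn, weightMeasure, restrict_withDensity (hcube Q hQ).measurableSet,
      integrable_withDensity_iff_integrable_smul₀' hσ.aemeasurable_ofReal.restrict (by simp)] at h1
    refine h1.congr (Filter.Eventually.of_forall fun x => ?_)
    simp only [ENNReal.toReal_ofReal (hσ.nonneg x), Complex.real_smul]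
  · -- the weak-type bound forces `T` to be finite almost everywhere
    set c := C * ENNReal.ofReal Λ * twoWeightAp p q w σ * aInfty w ^ (1 / q) *
      eLpNorm f (ENNReal.ofReal p) (weightMeasure σ) with hc_def
    have hc : c ≠ ∞ := by
      rw [hc_def, mul_assoc (C * ENNReal.ofReal Λ)]
      exact ENNReal.mul_ne_top (ENNReal.mul_ne_top (by finiteness) hfin) hf.2.ne
    have hzero : weightMeasure w {x | T x = ∞} = 0 := by
      by_contra h0
      set m := weightMeasure w {x | T x = ∞} ^ (1 / p)
      have hm0 : m ≠ 0 := by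
        simp [m, ENNReal.rpow_eq_zero_iff, h0, hp0.not_gt]
      have hle : ∀ t : ℝ≥0, t * m ≤ c := fun t => by
        refine le_trans ?_ (hweak t)
        refine mul_le_mul' le_rfl (ENNReal.rpow_le_rpow (measure_mono fun x hx => ?_) hp'.le)
        rw [mem_ofPred_eq] at hx ⊢
        rw [hx]
        exact ENNReal.coe_lt_top
      obtain ⟨t, ht⟩ := ENNReal.exists_nat_mul_gt hm0 hc
      exact absurd (hle t) (not_le.2 (by simpa using ht))
    have hae : ∀ᵐ x ∂weightMeasure w, T x ≠ ∞ := by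
      rw [ae_iff]
      simpa using hzero
    filter_upwards [hae] with x hx
    have h1 := ne_top_of_le_ne_top hx (hsum x)
    have h2 := ENNReal.tsum_coe_ne_top_iff_summable.1 h1
    exact NNReal.summable_coe.2 h2
  · refine iSup₂_le fun t _ => le_trans ?_ (hweak t)
    gcongr with x
    intro hx
    exact lt_of_lt_of_le (ENNReal.coe_lt_coe.2 hx) (hop x)
  · refine le_trans ?_ hstrong
    rw [eLpNorm_eq_lintegral_rpow_enorm_toReal hpE ENNReal.ofReal_ne_top, hpR]
    gcongr with x
    exact hop x
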